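/- Let $R$ be a commutative ring, let $N:\mathrm{sMod}_R\to\mathrm{Ch}_{\ge 0}(R)$ be the normalization functor from simplicial $R$-modules to non-negatively graded chain complexes of $R$-modules, and let $\Gamma$ be its Dold–Kan inverse. For simplicial $R$-modules $A,B$ let $B^A:=\underline{\mathrm{Hom}}_{\mathrm{sMod}_R}(A,B)$ be the internal hom, with $(B^A)_n=\mathrm{Hom}_{\mathrm{sMod}_R}(A\otimes R\Delta^n,B)$, and let $N(B)^{N(A)}:=\underline{\mathrm{Hom}}_{\mathrm{Ch}_{\ge 0}(R)}(N(A),N(B))$ be the internal hom complex, i.e. the good truncation $\tau_{\ge0}$ of the complex with $n$-chains $\prod_i\mathrm{Hom}_R(N(A)_i,N(B)_{i+n})$ and $(df)(x)=d(f(x))-(-1)^{|f|}f(d(x))$. Let $\mathrm{EZ}:N(A)\otimes N(K)\to N(A\otimes K)$ and $\mathrm{AW}:N(A\otimes K)\to N(A)\otimes N(K)$ be the normalized Eilenberg–Zilber (shuffle) and Alexander–Whitney maps. By the Dold–Kan correspondence and the tensor-hom adjunctions, chain maps $N(K)\to N(B^A)$ correspond to chain maps $N(A\otimes K)\to N(B)$,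 and chain maps $N(K)\to N(B)^{N(A)}$ correspond to chain maps $N(A)\otimes N(K)\to N(B)$, naturally in the simplicial $R$-module $K$. Under these identifications (for $K=\Gamma(D^n)$, with $D^n$ the $n$-disk complex, one obtains the $n$-chains of the two complexes), precomposition with $\mathrm{EZ}$ and $\mathrm{AW}$ defines chain maps, natural in $A$ and $B$, $$\mathrm{EZ}^*:N(B^A)\to N(B)^{N(A)},\qquad \mathrm{AW}^*:N(B)^{N(A)}\to N(B^A).$$ Then $N(B)^{N(A)}$ is a deformation retract of $N(B^A)$ via these maps: $\mathrm{EZ}^*\circ\mathrm{AW}^*=\mathrm{id}$, and $\mathrm{AW}^*\circ\mathrm{EZ}^*$ is chain homotopic to the identity of $N(B^A)$ by a chain homotopy natural in $A$ and $B$. -/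

import Mathlib

open CategoryTheory MonoidalCategory Opposite AlgebraicTopology Simplicial

universe u

noncomputable section

namespace SMod

variable (R : Type u) [CommRing R]

/-! ### The hom complex of non-negatively graded chain complexes -/

/-- Chains of degree `n` of the internal hom of non-negatively graded chain complexes: families
`f p q : X_p ⟶ Y_q` supported on `q = p + n`, i.e. elements of `∏ p, Hom (X_p, Y_{p+n})`.
In degree `0` the good truncation imposes that `f` is a cycle, i.e. a chain map.
(At `p = 0` the term `X.d 0 (0 - 1) = X.d 0 0` is zero.) -/
def homChains (X Y : ChainComplex (ModuleCat.{u} R) ℕ) (n : ℕ) :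
    Submodule R (∀ p q : ℕ, X.X p ⟶ Y.X q) where
  carrier := {f | (∀ p q, p + n ≠ q → f p q = 0) ∧
    (n = 0 → ∀ p q, f p (q + 1) ≫ Y.d (q + 1) q = X.d p (p - 1) ≫ f (p - 1) q)}
  add_mem' {f g} hf hg := ⟨fun p q h => by simp [hf.1 p q h, hg.1 p q h], fun h p q => by
    simp [Preadditive.add_comp, Preadditive.comp_add, hf.2 h p q, hg.2 h p q]⟩
  zero_mem' := ⟨fun p q h => rfl, fun h p q => by simp⟩
  smul_mem' r f hf := ⟨fun p q h => by simp [hf.1 p q h], fun h p q => by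
    simp [Linear.smul_comp, Linear.comp_smul, hf.2 h p q]⟩

/-- The differential `d f = d ∘ f - (-1)^n f ∘ d` of a family `f` of degree `n`. -/
def homDiff (X Y : ChainComplex (ModuleCat.{u} R) ℕ) (n : ℕ) :
    (∀ p q : ℕ, X.X p ⟶ Y.X q) →ₗ[R] (∀ p q : ℕ, X.X p ⟶ Y.X q) where
  toFun f p q := f p (q + 1) ≫ Y.d (q + 1) q - (-1 : R) ^ n • (X.d p (p - 1) ≫ f (p - 1) q)
  map_add' f g := by
    funext p q
    simp only [Pi.add_apply, Preadditive.add_comp, Preadditive.comp_add, smul_add]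
    abel
  map_smul' r f := by
    funext p q
    simp only [Pi.smul_apply, Linear.smul_comp, Linear.comp_smul, RingHom.id_apply, smul_sub,
      smul_comm r]

variable {R}

lemma homDiff_homDiff (X Y : ChainComplex (ModuleCat.{u} R) ℕ) (n : ℕ)
    (f : ∀ p q : ℕ, X.X p ⟶ Y.X q) : homDiff R X Y n (homDiff R X Y (n + 1) f) = 0 := by
  funext p q
  simp [homDiff, pow_succ]

lemma homDiff_mem (X Y : ChainComplex (ModuleCat.{u} R) ℕ) (n : ℕ)
    (f : ∀ p q : ℕ, X.X p ⟶ Y.X q) (hf : f ∈ homChains R X Y (n + 1)) :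
    homDiff R X Y (n + 1) f ∈ homChains R X Y n := by
  refine ⟨fun p q h => ?_, fun hn p q => ?_⟩
  · have h1 : f p (q + 1) = 0 := hf.1 _ _ (by omega)
    rcases p with _ | p
    · simp [homDiff, h1]
    · have h2 : f p q = 0 := hf.1 _ _ (by omega)
      simp [homDiff, h1, h2]
  · subst hn
    have := congrFun (congrFun (homDiff_homDiff X Y 0 f) p) q
    simp only [homDiff, LinearMap.coe_mk, AddHom.coe_mk, pow_zero, one_smul, Pi.zero_apply,
      sub_eq_zero] at this
    exact this

/-- The internal hom `Hom(X, Y)` of non-negatively graded chain complexes of `R`-modules. -/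
def homComplex (X Y : ChainComplex (ModuleCat.{u} R) ℕ) : ChainComplex (ModuleCat.{u} R) ℕ :=
  ChainComplex.of (fun n => ModuleCat.of R (homChains R X Y n))
    (fun n => ModuleCat.ofHom ((homDiff R X Y (n + 1)).restrict (homDiff_mem X Y n)))
    (fun n => by
      refine ModuleCat.hom_ext (LinearMap.ext fun f => Subtype.ext ?_)
      exact homDiff_homDiff X Y (n + 1) f.1)

/-- The linear map `f ↦ β ∘ f ∘ α` on families. -/
def homConj {X Y X' Y' : ChainComplex (ModuleCat.{u} R) ℕ} (α : X' ⟶ X) (β : Y ⟶ Y') :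
    (∀ p q : ℕ, X.X p ⟶ Y.X q) →ₗ[R] (∀ p q : ℕ, X'.X p ⟶ Y'.X q) where
  toFun f p q := α.f p ≫ f p q ≫ β.f q
  map_add' f g := by funext p q; simp [Preadditive.add_comp, Preadditive.comp_add]
  map_smul' r f := by funext p q; simp [Linear.smul_comp, Linear.comp_smul]

lemma homConj_homDiff {X Y X' Y' : ChainComplex (ModuleCat.{u} R) ℕ} (α : X' ⟶ X) (β : Y ⟶ Y')
    (n : ℕ) (f : ∀ p q : ℕ, X.X p ⟶ Y.X q) :
    homDiff R X' Y' n (homConj α β f) = homConj α β (homDiff R X Y n f) := by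
  funext p q
  simp [homDiff, homConj, Preadditive.sub_comp, Preadditive.comp_sub, Linear.smul_comp,
    Linear.comp_smul]

lemma homConj_mem {X Y X' Y' : ChainComplex (ModuleCat.{u} R) ℕ} (α : X' ⟶ X) (β : Y ⟶ Y')
    (n : ℕ) (f : ∀ p q : ℕ, X.X p ⟶ Y.X q) (hf : f ∈ homChains R X Y n) :
    homConj α β f ∈ homChains R X' Y' n := by
  refine ⟨fun p q h => by simp [homConj, hf.1 p q h], fun hn p q => ?_⟩
  have h2 := hf.2 hn p q
  simp only [homConj, LinearMap.coe_mk, AddHom.coe_mk, Category.assoc,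
    HomologicalComplex.Hom.comm]
  rw [reassoc_of% h2, HomologicalComplex.Hom.comm_assoc]

lemma homConj_id {X Y : ChainComplex (ModuleCat.{u} R) ℕ} (f : ∀ p q : ℕ, X.X p ⟶ Y.X q) :
    homConj (𝟙 X) (𝟙 Y) f = f := by
  funext p q
  simp [homConj]

lemma homConj_comp {X Y X' Y' X'' Y'' : ChainComplex (ModuleCat.{u} R) ℕ}
    (α : X' ⟶ X) (β : Y ⟶ Y') (α' : X'' ⟶ X') (β' : Y' ⟶ Y'')
    (f : ∀ p q : ℕ, X.X p ⟶ Y.X q) :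
    homConj (α' ≫ α) (β ≫ β') f = homConj α' β' (homConj α β f) := by
  funext p q
  simp [homConj]

/-- Functoriality of `homComplex`, contravariant in the first and covariant in the second
variable. -/
def homComplexFunctor :
    (ChainComplex (ModuleCat.{u} R) ℕ)ᵒᵖ × ChainComplex (ModuleCat.{u} R) ℕ ⥤
      ChainComplex (ModuleCat.{u} R) ℕ where
  obj P := homComplex P.1.unop P.2
  map {P Q} φ := ChainComplex.ofHom
    (fun n => ModuleCat.ofHom ((homConj φ.1.unop φ.2).restrict (homConj_mem φ.1.unop φ.2 n)))
    (fun n => by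
      ext f
      refine Subtype.ext ?_
      simp only [homComplex, ChainComplex.of_d]
      exact homConj_homDiff φ.1.unop φ.2 (n + 1) f.1)
  map_id P := by
    refine HomologicalComplex.hom_ext _ _ fun n =>
      ModuleCat.hom_ext (LinearMap.ext fun f => Subtype.ext ?_)
    exact homConj_id f.1
  map_comp {P Q S} φ ψ := by
    refine HomologicalComplex.hom_ext _ _ fun n =>
      ModuleCat.hom_ext (LinearMap.ext fun f => Subtype.ext ?_)
    exact homConj_comp φ.1.unop φ.2 ψ.1.unop ψ.2 f.1

/-! ### The internal hom of simplicial modules -/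

variable (R) in
/-- The cosimplicial simplicial `R`-module `n ↦ RΔⁿ`. -/
def freeSimplex : SimplexCategory ⥤ SimplicialObject (ModuleCat.{u} R) :=
  SSet.stdSimplex.{u} ⋙ (Functor.whiskeringRight _ _ _).obj (ModuleCat.free R)

/-- The simplicial `R`-module `B^A` with `n`-simplices `Hom(A ⊗ RΔⁿ, B)`, as a functor of
`(A, B)`. The tensor product of simplicial modules is degreewise. -/
def simplicialHom :
    (SimplicialObject (ModuleCat.{u} R))ᵒᵖ × SimplicialObject (ModuleCat.{u} R) ⥤
      SimplicialObject (ModuleCat.{u} R) where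
  obj P :=
    { obj := fun n => ModuleCat.of R (P.1.unop ⊗ (freeSimplex R).obj n.unop ⟶ P.2)
      map := fun θ => ModuleCat.ofHom
        (Linear.leftComp R P.2 (P.1.unop ◁ (freeSimplex R).map θ.unop))
      map_id := fun n => by ext f; simp [Linear.leftComp]
      map_comp := fun θ η => by ext f; simp [Linear.leftComp] }
  map {P Q} φ :=
    { app := fun n => ModuleCat.ofHom
        ((Linear.rightComp R _ φ.2).comp
          (Linear.leftComp R P.2 (φ.1.unop ▷ (freeSimplex R).obj n.unop)))
      naturality := fun n m θ => by
        ext f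
        simp [Linear.leftComp, Linear.rightComp, whisker_exchange_assoc] }
  map_id P := by
    ext n f
    simp [Linear.leftComp, Linear.rightComp]
  map_comp φ ψ := by
    ext n f
    simp [Linear.leftComp, Linear.rightComp]

/-- The evaluation `A ⊗ B^A ⟶ B`: in degree `m` it sends `a ⊗ f`, where
`f : A ⊗ RΔᵐ ⟶ B`, to `f (a ⊗ ι_m)`, with `ι_m` the fundamental simplex of `Δᵐ`. -/
def simplicialEval (A B : SimplicialObject (ModuleCat.{u} R)) :
    A ⊗ simplicialHom.obj (op A, B) ⟶ B where
  app m := ModuleCat.ofHom (TensorProduct.lift (LinearMap.flip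
    { toFun := fun (f : A ⊗ (freeSimplex R).obj m.unop ⟶ B) =>
        (f.app m).hom ∘ₗ (TensorProduct.mk R (A.obj m) (((freeSimplex R).obj m.unop).obj m)).flip
          (ModuleCat.freeMk (SSet.stdSimplex.objEquiv.symm (𝟙 m.unop)))
      map_add' := fun f g => rfl
      map_smul' := fun r f => rfl }))
  naturality m m' θ := by
    refine ModuleCat.hom_ext (TensorProduct.ext' fun a f => ?_)
    have h1 := congrArg (fun g => g.hom (a ⊗ₜ[R] (ModuleCat.freeMk
      (SSet.stdSimplex.objEquiv.symm (𝟙 m.unop)) : ((freeSimplex R).obj m.unop).obj m)))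
      (f.naturality θ)
    refine Eq.trans ?_ h1
    change (f.app m').hom (A.map θ a ⊗ₜ[R] ((freeSimplex R).map θ.unop).app m'
        (ModuleCat.freeMk (SSet.stdSimplex.objEquiv.symm (𝟙 m'.unop)))) =
      (f.app m').hom (A.map θ a ⊗ₜ[R] ((freeSimplex R).obj m.unop).map θ
        (ModuleCat.freeMk (SSet.stdSimplex.objEquiv.symm (𝟙 m.unop))))
    congr 2
    refine (ModuleCat.free_map_apply (R := R) ((SSet.stdSimplex.map θ.unop).app m') _).trans
      (Eq.trans ?_ (ModuleCat.free_map_apply (R := R)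
        ((SSet.stdSimplex.obj m.unop).map θ) _).symm)
    rw [SSet.stdSimplex.map_objEquiv_symm, ← SSet.stdSimplex.objEquiv_symm_comp (m := m'),
      Category.id_comp, Category.comp_id]

/-- The transpose `A ⊗ K ⟶ B` of a map `K ⟶ B^A` of simplicial modules. -/
def simplicialTranspose {A B K : SimplicialObject (ModuleCat.{u} R)}
    (ψ : K ⟶ simplicialHom.obj (op A, B)) : A ⊗ K ⟶ B :=
  (A ◁ ψ) ≫ simplicialEval A B

/-! ### The Eilenberg--Zilber and Alexander--Whitney maps -/

variable (R) in
/-- The normalization functor: `(N A)_n` is the intersection of the kernels of the faces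
`d_1, …, d_n` of `A_n`, with differential `d_0`. It is canonically isomorphic to the quotient of
the alternating face map complex of `A` by its degenerate subcomplex. -/
abbrev normalization : SimplicialObject (ModuleCat.{u} R) ⥤ ChainComplex (ModuleCat.{u} R) ℕ :=
  normalizedMooreComplex (ModuleCat.{u} R)

/-- The inclusion `(N A)_n ⟶ A_n`. -/
def normIncl (A : SimplicialObject (ModuleCat.{u} R)) (n : ℕ) :
    ((normalization R).obj A).X n ⟶ A.obj (op ⦋n⦌) :=
  (inclusionOfMooreComplexMap A).f n

/-- The canonical projection `A_n ⟶ (N A)_n`, with kernel the span of the degenerate simplices. -/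
def normProj (A : SimplicialObject (ModuleCat.{u} R)) (n : ℕ) :
    A.obj (op ⦋n⦌) ⟶ ((normalization R).obj A).X n :=
  (DoldKan.PInftyToNormalizedMooreComplex A).f n

/-- The monotone surjection `[n] ⟶ [k]` which, for `μ ⊆ {0, …, n - 1}` of cardinality `k`,
increases by one from `i` to `i + 1` if `i ∈ μ` and is constant there otherwise. It is the composite
of the codegeneracies indexed by the complement of `μ`. -/
def stepMap {n k : ℕ} (μ : Finset (Fin n)) (h : μ.card = k) : ⦋n⦌ ⟶ ⦋k⦌ :=
  SimplexCategory.mkHom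
    { toFun := fun i => ⟨(μ.filter fun j => j.castSucc < i).card,
        Nat.lt_succ_of_le (h ▸ Finset.card_filter_le _ _)⟩
      monotone' := fun _ _ hi => Finset.card_le_card
        (Finset.monotone_filter_right μ fun _ _ hj => lt_of_lt_of_le hj hi) }

/-- The number of inversions of the shuffle which lists the elements of `μ` before those of its
complement: pairs `(i, j)` with `i ∈ μ`, `j ∉ μ` and `j < i`. -/
def inversions {n : ℕ} (μ : Finset (Fin n)) : ℕ :=
  ((μ ×ˢ μᶜ).filter fun x => x.2 < x.1).card

/-- The shuffle map `A_p ⊗ B_q ⟶ (A ⊗ B)_{p+q}`,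
`a ⊗ b ↦ ∑ sgn(μ, ν) s_{ν_q} ⋯ s_{ν_1} a ⊗ s_{μ_p} ⋯ s_{μ_1} b`, the sum being over all
`(p, q)`-shuffles `(μ, ν)` of `{0, …, p + q - 1}`. -/
def shuffleMap (A B : SimplicialObject (ModuleCat.{u} R)) (p q : ℕ) :
    A.obj (op ⦋p⦌) ⊗ B.obj (op ⦋q⦌) ⟶ (A ⊗ B).obj (op ⦋p + q⦌) :=
  ∑ μ : {μ : Finset (Fin (p + q)) // μ.card = p}, (-1 : R) ^ inversions μ.1 •
    (A.map (stepMap μ.1 μ.2).op ⊗ₘ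
      B.map (stepMap μ.1ᶜ (by rw [Finset.card_compl, Fintype.card_fin, μ.2]; omega)).op)

/-- The component `(N A)_p ⊗ (N B)_q ⟶ N(A ⊗ B)_{p+q}` of the Eilenberg--Zilber map
`EZ : N A ⊗ N B ⟶ N(A ⊗ B)`. -/
def EZ (A B : SimplicialObject (ModuleCat.{u} R)) (p q : ℕ) :
    ((normalization R).obj A).X p ⊗ ((normalization R).obj B).X q ⟶
      ((normalization R).obj (A ⊗ B)).X (p + q) :=
  (normIncl A p ⊗ₘ normIncl B q) ≫ shuffleMap A B p q ≫ normProj (A ⊗ B) (p + q)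

/-- The component `N(A ⊗ B)_n ⟶ (N A)_p ⊗ (N B)_q`, for `p + q = n`, of the Alexander--Whitney map
`AW : N(A ⊗ B) ⟶ N A ⊗ N B`. It is induced by sending `a ⊗ b` to the tensor product of the front
`p`-face of `a` with the back `q`-face of `b`. -/
def AW (A B : SimplicialObject (ModuleCat.{u} R)) (p q n : ℕ) (h : p + q = n) :
    ((normalization R).obj (A ⊗ B)).X n ⟶
      ((normalization R).obj A).X p ⊗ ((normalization R).obj B).X q :=
  normIncl (A ⊗ B) n ≫
    (A.map (SimplexCategory.subinterval 0 p (by omega)).op ⊗ₘ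
      B.map (SimplexCategory.subinterval p q (by omega)).op) ≫
    (normProj A p ⊗ₘ normProj B q)

/-! ### Duality -/

/-- For a map `φ : K ⟶ Hom(X, Y)` of chain complexes, the component `X_p ⊗ K_q ⟶ Y_n`
(for `p + q = n`) of its transpose `X ⊗ K ⟶ Y`, namely `x ⊗ k ↦ (-1)^{pq} φ(k)(x)`. The sign is that
of the symmetry of the tensor product of chain complexes. -/
def chainTranspose {X Y K : ChainComplex (ModuleCat.{u} R) ℕ}
    (φ : K ⟶ homComplexFunctor.obj (op X, Y)) (p q n : ℕ) : X.X p ⊗ K.X q ⟶ Y.X n :=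
  (-1 : R) ^ (p * q) • ModuleCat.ofHom (TensorProduct.lift (LinearMap.flip
    { toFun := fun k : K.X q => (((φ.f q).hom k : homChains R X Y q).1 p n).hom
      map_add' := fun k l => by rw [map_add]; rfl
      map_smul' := fun r k => by rw [map_smul]; rfl }))

variable (R) in
/-- The functor `(A, B) ↦ N(B^A)`. -/
def normHom : (SimplicialObject (ModuleCat.{u} R))ᵒᵖ × SimplicialObject (ModuleCat.{u} R) ⥤
    ChainComplex (ModuleCat.{u} R) ℕ :=
  simplicialHom ⋙ normalization R

variable (R) in
/-- The functor `(A, B) ↦ N(B)^{N(A)} = Hom(N(A), N(B))`. -/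
def homNorm : (SimplicialObject (ModuleCat.{u} R))ᵒᵖ × SimplicialObject (ModuleCat.{u} R) ⥤
    ChainComplex (ModuleCat.{u} R) ℕ :=
  (normalization R).op.prod (normalization R) ⋙ homComplexFunctor

/-- `e : N(B^A) ⟶ Hom(N A, N B)` is the dual `EZ^*` of the Eilenberg--Zilber map: under the
Dold--Kan correspondence and the tensor-hom adjunctions, a map `N K ⟶ N(B^A)` is the same as a map
`f : N(A ⊗ K) ⟶ N B` and a map `N K ⟶ Hom(N A, N B)` is the same as a map `N A ⊗ N K ⟶ N B`, and
composition with `e` is `f ↦ f ∘ EZ`. (For `K = Γ(Dⁿ)`, with `Dⁿ` the `n`-disk, this describes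
`e` on `n`-chains.) -/
def IsEZDual {A B : SimplicialObject (ModuleCat.{u} R)}
    (e : (normHom R).obj (op A, B) ⟶ (homNorm R).obj (op A, B)) : Prop :=
  ∀ (K : SimplicialObject (ModuleCat.{u} R)) (ψ : K ⟶ simplicialHom.obj (op A, B)) (p q : ℕ),
    chainTranspose (X := (normalization R).obj A) (Y := (normalization R).obj B)
        ((normalization R).map ψ ≫ e) p q (p + q) =
      EZ A K p q ≫ ((normalization R).map (simplicialTranspose ψ)).f (p + q)

/-- `a : Hom(N A, N B) ⟶ N(B^A)` is the dual `AW^*` of the Alexander--Whitney map: with the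
identifications described in `IsEZDual`, if `g : N A ⊗ N K ⟶ N B` corresponds to
`φ : N K ⟶ Hom(N A, N B)`, then `φ ≫ a`, which is `N ψ` for a unique `ψ : K ⟶ B^A`, corresponds to
`g ∘ AW : N(A ⊗ K) ⟶ N B`. -/
def IsAWDual {A B : SimplicialObject (ModuleCat.{u} R)}
    (a : (homNorm R).obj (op A, B) ⟶ (normHom R).obj (op A, B)) : Prop :=
  ∀ (K : SimplicialObject (ModuleCat.{u} R)) (ψ : K ⟶ simplicialHom.obj (op A, B))
    (φ : (normalization R).obj K ⟶ (homNorm R).obj (op A, B)),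
    (normalization R).map ψ = φ ≫ a → ∀ n : ℕ,
      ((normalization R).map (simplicialTranspose ψ)).f n =
        ∑ x : Finset.HasAntidiagonal.antidiagonal n,
          AW A K x.1.1 x.1.2 n (Finset.HasAntidiagonal.mem_antidiagonal.1 x.2) ≫
            chainTranspose (X := (normalization R).obj A) (Y := (normalization R).obj B)
              φ x.1.1 x.1.2 n

end SMod

end

noncomputable section

namespace SMod

variable {R : Type u} [CommRing R]

/-! ### The normalized complex as a retract of the alternating face map complex. -/

section

variable (A B : SimplicialObject (ModuleCat.{u} R)) (n : ℕ)

lemma normIncl_eq : normIncl A n = (NormalizedMooreComplex.objX A n).arrow :=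
  inclusionOfMooreComplexMap_f A n

instance : Mono (normIncl A n) := by
  rw [normIncl_eq]; exact inferInstanceAs (Mono (NormalizedMooreComplex.objX A n).arrow)

variable {A B} in
lemma normMap_normIncl (f : A ⟶ B) : ((normalization R).map f).f n ≫ normIncl B n =
    normIncl A n ≫ f.app (op ⦋n⦌) :=
  HomologicalComplex.congr_hom ((inclusionOfMooreComplex _).naturality f) n

lemma normIncl_δ_succ (i : Fin (n+1)) : normIncl A (n+1) ≫ A.δ i.succ = 0 :=
  DoldKan.HigherFacesVanish.inclusionOfMooreComplexMap n i (by omega)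

lemma d_normIncl : ((normalization R).obj A).d (n+1) n ≫ normIncl A n =
    normIncl A (n+1) ≫ A.δ 0 := by
  refine ((inclusionOfMooreComplexMap A).comm (n + 1) n).symm.trans ?_
  refine (congrArg (normIncl A (n + 1) ≫ ·) (alternatingFaceMapComplex_obj_d A n)).trans ?_
  change normIncl A (n + 1) ≫ ∑ i : Fin (n + 2), (-1 : ℤ) ^ (i : ℕ) • A.δ i = _
  rw [Fin.sum_univ_succ, Preadditive.comp_add, Preadditive.comp_sum, Finset.sum_eq_zero]
  · simp
  · intro i _
    rw [Preadditive.comp_zsmul, normIncl_δ_succ, smul_zero]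

lemma normProj_normIncl : normProj A n ≫ normIncl A n = DoldKan.PInfty.f n :=
  HomologicalComplex.congr_hom
      (DoldKan.PInftyToNormalizedMooreComplex_comp_inclusionOfMooreComplexMap A) n

lemma normIncl_normProj : normIncl A n ≫ normProj A n = 𝟙 _ :=
  HomologicalComplex.congr_hom (DoldKan.splitMonoInclusionOfMooreComplexMap A).id n

variable {A B} in
lemma app_normProj (f : A ⟶ B) : f.app (op ⦋n⦌) ≫ normProj B n =
   normProj A n ≫ ((normalization R).map f).f n :=
  HomologicalComplex.congr_hom (DoldKan.PInftyToNormalizedMooreComplex_naturality f) n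

/-- Pullback along a non-injective map produces degenerate simplices, which `PInfty` kills. This
eliminates all shuffles but one in the composite of `EZ` and `AW`. -/
lemma map_normProj_eq_zero {Δ : SimplexCategory} (θ : ⦋n⦌ ⟶ Δ)
    (hθ : ¬ Function.Injective θ.toOrderHom) :
    A.map θ.op ≫ normProj A n = 0 := by
  rw [← cancel_mono (normIncl A n), Category.assoc, normProj_normIncl, Limits.zero_comp]
  exact DoldKan.degeneracy_comp_PInfty A n θ (by rwa [SimplexCategory.mono_iff_injective])

lemma normProj_d : normProj A (n+1) ≫ ((normalization R).obj A).d (n+1) n =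
    (∑ i : Fin (n+2), (-1 : R) ^ (i : ℕ) • A.δ i) ≫ normProj A n := by
  refine ((DoldKan.PInftyToNormalizedMooreComplex A).comm (n+1) n).trans ?_
  refine congrArg (· ≫ normProj A n) ?_
  refine (alternatingFaceMapComplex_obj_d A n).trans ?_
  refine Finset.sum_congr rfl fun i _ => ?_
  rcases Nat.even_or_odd (i : ℕ) with h | h <;> simp [h.neg_one_pow]

/-- `PInfty` fixes chains on which all positive faces vanish, so projecting such a chain to `N A`
changes nothing. -/
lemma normProj_normIncl_of_vanish {Y : ModuleCat.{u} R} (f : Y ⟶ A.obj (op ⦋n+1⦌))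
   (hf : ∀ i : Fin (n+1), f ≫ A.δ i.succ = 0) : f ≫ normProj A (n+1) ≫ normIncl A (n+1) = f := by
  rw [normProj_normIncl]
  exact DoldKan.HigherFacesVanish.comp_P_eq_self (q := n+1) (fun j _ => hf j)

lemma normProj_normIncl_zero : normProj A 0 ≫ normIncl A 0 = 𝟙 _ := normProj_normIncl A 0

end

/-! ### Front and back faces; the Alexander–Whitney map is a chain map. -/

section

lemma subinterval_apply_val {n} (j l : ℕ) (h : j + l ≤ n) (x) :
    ((SimplexCategory.subinterval j l h).toOrderHom x : ℕ) = x + j := rfl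

lemma δ_apply_val {n : ℕ} (i : Fin (n + 2)) (x : Fin (n + 1)) :
    ((x : ℕ) < i ∧ ((SimplexCategory.δ i).toOrderHom x : ℕ) = x) ∨
      ((i : ℕ) ≤ x ∧ ((SimplexCategory.δ i).toOrderHom x : ℕ) = x + 1) := by
  change _ ∧ ((i.succAbove x : Fin (n + 2)) : ℕ) = _ ∨ _ ∧ ((i.succAbove x : Fin (n + 2)) : ℕ) = _
  rcases lt_or_ge (x : ℕ) i with h | h
  · exact Or.inl ⟨h, by rw [Fin.succAbove_of_castSucc_lt _ _ h]; rfl⟩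
  · exact Or.inr ⟨h, by rw [Fin.succAbove_of_le_castSucc _ _ h]; rfl⟩

lemma simplexHom_ext {n m : ℕ} {f g : ⦋n⦌ ⟶ ⦋m⦌}
    (h : ∀ x, (f.toOrderHom x : ℕ) = g.toOrderHom x) : f = g := by
  ext x
  exact h x

lemma comp_apply_val {n m k : ℕ} (f : ⦋n⦌ ⟶ ⦋m⦌) (g : ⦋m⦌ ⟶ ⦋k⦌) (x) :
    ((f ≫ g).toOrderHom x : ℕ) = g.toOrderHom (f.toOrderHom x) := rfl

lemma front_δ_of_le {n p : ℕ} (i : Fin (n + 2)) (j : Fin (p + 2)) (hp : p ≤ n)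
    (hij : (i : ℕ) = j) :
    SimplexCategory.subinterval 0 p (by omega) ≫ SimplexCategory.δ i =
     SimplexCategory.δ j ≫ SimplexCategory.subinterval 0 (p + 1) (by omega) := by
  apply simplexHom_ext
  intro x
  have h1 := δ_apply_val i ((SimplexCategory.subinterval (n := n) 0 p (by omega)).toOrderHom x)
  have h2 := δ_apply_val j x
  simp only [comp_apply_val, subinterval_apply_val] at h1 ⊢
  omega

lemma front_δ_of_gt {n p : ℕ} (i : Fin (n + 2)) (hp : p ≤ n) (hi : p < (i : ℕ)) :
    SimplexCategory.subinterval 0 p (by omega) ≫ SimplexCategory.δ i =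
     SimplexCategory.subinterval 0 p (by omega) := by
  apply simplexHom_ext
  intro x
  have : (x : ℕ) < p + 1 := x.2
  have h1 := δ_apply_val i ((SimplexCategory.subinterval (n := n) 0 p (by omega)).toOrderHom x)
  simp only [comp_apply_val, subinterval_apply_val] at h1 ⊢
  omega

lemma back_δ_of_le {n p q : ℕ} (i : Fin (n + 2)) (h : p + q ≤ n) (hi : (i : ℕ) ≤ p) :
    SimplexCategory.subinterval p q h ≫ SimplexCategory.δ i =
     SimplexCategory.subinterval (p + 1) q (by omega) := by
  apply simplexHom_ext
  intro x
  have h1 := δ_apply_val i ((SimplexCategory.subinterval p q h).toOrderHom x)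
  simp only [comp_apply_val, subinterval_apply_val] at h1 ⊢
  omega

lemma back_δ_of_ge {n p q : ℕ} (i : Fin (n + 2)) (j : Fin (q + 2)) (h : p + q ≤ n)
    (hij : (i : ℕ) = p + j) :
    SimplexCategory.subinterval p q h ≫ SimplexCategory.δ i =
     SimplexCategory.δ j ≫ SimplexCategory.subinterval p (q + 1) (by omega) := by
  apply simplexHom_ext
  intro x
  have h1 := δ_apply_val i ((SimplexCategory.subinterval p q h).toOrderHom x)
  have h2 := δ_apply_val j x
  simp only [comp_apply_val, subinterval_apply_val] at h1 ⊢
  omega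

lemma front_last {n p : ℕ} (hp : p + 1 ≤ n) :
    SimplexCategory.δ (Fin.last (p + 1)) ≫ SimplexCategory.subinterval 0 (p + 1) (by omega) =
      (SimplexCategory.subinterval 0 p (by omega) : _ ⟶ ⦋n⦌) := by
  apply simplexHom_ext
  intro x
  have : (x : ℕ) < p + 1 := x.2
  have h2 := δ_apply_val (Fin.last (p + 1)) x
  simp only [comp_apply_val, subinterval_apply_val, Fin.val_last] at h2 ⊢
  omega

lemma back_first {n p q : ℕ} (h : p + (q + 1) ≤ n) :
    SimplexCategory.δ (0 : Fin (q + 2)) ≫ SimplexCategory.subinterval p (q + 1) h =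
      (SimplexCategory.subinterval (p + 1) q (by omega) : _ ⟶ ⦋n⦌) := by
  apply simplexHom_ext
  intro x
  have h2 := δ_apply_val (0 : Fin (q + 2)) x
  simp only [comp_apply_val, subinterval_apply_val, Fin.val_zero] at h2 ⊢
  omega

variable (A B : SimplicialObject (ModuleCat.{u} R))

/-- The differential of the alternating face map complex. -/
def alternatingD (n : ℕ) : A.obj (op ⦋n + 1⦌) ⟶ A.obj (op ⦋n⦌) :=
  ∑ i : Fin (n + 2), (-1 : R) ^ (i : ℕ) • A.δ i

lemma normIncl_alternatingD (n : ℕ) : normIncl A (n + 1) ≫ alternatingD A n =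
    ((normalization R).obj A).d (n + 1) n ≫ normIncl A n := by
  rw [d_normIncl, alternatingD, Fin.sum_univ_succ, Preadditive.comp_add, Preadditive.comp_sum,
    Finset.sum_eq_zero]
  · simp
  · intro i _
    rw [Linear.comp_smul, normIncl_δ_succ, smul_zero]

lemma alternatingD_normProj (n : ℕ) : alternatingD A n ≫ normProj A n =
    normProj A (n + 1) ≫ ((normalization R).obj A).d (n + 1) n :=
  (normProj_d A n).symm

/-- The unnormalized Alexander--Whitney map: the front face of the first factor tensored with the
back face of the second. -/
def frontBack (p q n : ℕ) (h : p + q = n) :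
    (A ⊗ B).obj (op ⦋n⦌) ⟶ A.obj (op ⦋p⦌) ⊗ B.obj (op ⦋q⦌) :=
  A.map (SimplexCategory.subinterval 0 p (by omega)).op ⊗ₘ
      B.map (SimplexCategory.subinterval p q (by omega)).op

lemma map_frontBack {p q n m : ℕ} (h : p + q = n) (θ : ⦋n⦌ ⟶ ⦋m⦌) :
    (A ⊗ B).map θ.op ≫ frontBack A B p q n h =
      A.map (SimplexCategory.subinterval 0 p (by omega) ≫ θ).op ⊗ₘ
      B.map (SimplexCategory.subinterval p q (by omega) ≫ θ).op := by
  refine (tensorHom_comp_tensorHom _ _ _ _).trans ?_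
  simp only [← Functor.map_comp, ← op_comp]

lemma frontBack_map {p q p' q' n : ℕ} (h : p + q = n) (θ : ⦋p'⦌ ⟶ ⦋p⦌) (η : ⦋q'⦌ ⟶ ⦋q⦌) :
    frontBack A B p q n h ≫ (A.map θ.op ⊗ₘ B.map η.op) =
      A.map (θ ≫ SimplexCategory.subinterval 0 p (by omega)).op ⊗ₘ
      B.map (η ≫ SimplexCategory.subinterval p q (by omega)).op := by
  refine (tensorHom_comp_tensorHom _ _ _ _).trans ?_
  simp only [← Functor.map_comp, ← op_comp]

lemma frontBack_map_left {p q p' n : ℕ} (h : p + q = n) (θ : ⦋p'⦌ ⟶ ⦋p⦌) :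
    frontBack A B p q n h ≫ (A.map θ.op ▷ _) =
      A.map (θ ≫ SimplexCategory.subinterval 0 p (by omega)).op ⊗ₘ
      B.map (SimplexCategory.subinterval p q (by omega)).op := by
  have := frontBack_map A B h θ (𝟙 _)
  rwa [Category.id_comp, op_id, B.map_id, tensorHom_id] at this

lemma frontBack_map_right {p q q' n : ℕ} (h : p + q = n) (η : ⦋q'⦌ ⟶ ⦋q⦌) :
    frontBack A B p q n h ≫ (_ ◁ B.map η.op) =
      A.map (SimplexCategory.subinterval 0 p (by omega)).op ⊗ₘ
      B.map (η ≫ SimplexCategory.subinterval p q (by omega)).op := by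
  have := frontBack_map A B h (𝟙 _) η
  rwa [Category.id_comp, op_id, A.map_id, id_tensorHom] at this

lemma δ_frontBack_of_le {p q n : ℕ} (h : p + q = n) (i : Fin (n + 2)) (j : Fin (p + 2))
    (hij : (i : ℕ) = j) (hj : (j : ℕ) ≤ p) :
    (A ⊗ B).δ i ≫ frontBack A B p q n h =
      frontBack A B (p + 1) q (n + 1) (by omega) ≫ (A.δ j ▷ _) := by
  refine (map_frontBack A B h _).trans (Eq.trans ?_ (frontBack_map_left A B _ _).symm)
  rw [front_δ_of_le i j (by omega) hij, back_δ_of_le i (by omega) (by omega)]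

lemma δ_frontBack_of_gt {p q n : ℕ} (h : p + q = n) (i : Fin (n + 2)) (j : Fin (q + 2))
    (hij : (i : ℕ) = p + j) (hj : 0 < (j : ℕ)) :
    (A ⊗ B).δ i ≫ frontBack A B p q n h =
      frontBack A B p (q + 1) (n + 1) (by omega) ≫ (_ ◁ B.δ j) := by
  refine (map_frontBack A B h _).trans (Eq.trans ?_ (frontBack_map_right A B _ _).symm)
  rw [front_δ_of_gt i (by omega) (by omega), back_δ_of_ge i j (by omega) hij]

/-- Both sides pair the face on `0, …, p` with the face on `p + 1, …, n + 1`. This pair comes from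
no face of the source, and its two occurrences must cancel. -/
lemma frontBack_δ_last {p q n : ℕ} (h : p + q = n) :
    frontBack A B (p + 1) q (n + 1) (by omega) ≫ (A.δ (Fin.last (p + 1)) ▷ _) =
      frontBack A B p (q + 1) (n + 1) (by omega) ≫ (_ ◁ B.δ 0) := by
  refine (frontBack_map_left A B _ _).trans (Eq.trans ?_ (frontBack_map_right A B _ _).symm)
  rw [front_last (by omega), back_first (by omega)]

/-- Faces with index at most `p` act on the front, the others on the back. The two leftover terms,
the last face of the front and the first face of the back, agree by `frontBack_δ_last` and carry the
signs `(-1)^(p+1)` and `(-1)^p`. -/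
lemma alternatingD_frontBack (p q n : ℕ) (h : p + q = n) :
    alternatingD (A ⊗ B) n ≫ frontBack A B p q n h =
      frontBack A B (p + 1) q (n + 1) (by omega) ≫ (alternatingD A p ▷ _) +
        (-1 : R) ^ p • (frontBack A B p (q + 1) (n + 1) (by omega) ≫ (_ ◁ alternatingD B q)) := by
  have h' : (p + 1) + (q + 1) = n + 2 := by omega
  simp only [alternatingD, Preadditive.sum_comp, Linear.smul_comp, sum_whiskerRight,
    whiskerLeft_sum, MonoidalLinear.smul_whiskerRight, MonoidalLinear.whiskerLeft_smul,
    Preadditive.comp_sum, Linear.comp_smul]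
  rw [← Fin.sum_congr' _ h', Fin.sum_univ_add, Fin.sum_univ_castSucc (n := p + 1),
    Fin.sum_univ_succ (n := q + 1), frontBack_δ_last A B h, smul_add, Finset.smul_sum]
  have e1 (i : Fin (p + 1)) : (A ⊗ B).δ (Fin.cast h' (Fin.castAdd (q + 1) i)) ≫
      frontBack A B p q n h = frontBack A B (p + 1) q (n + 1) (by omega) ≫ (A.δ i.castSucc ▷ _) :=
    δ_frontBack_of_le A B h _ _ rfl (by simp; omega)
  have e2 (i : Fin (q + 1)) : (A ⊗ B).δ (Fin.cast h' (Fin.natAdd (p + 1) i)) ≫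
      frontBack A B p q n h = frontBack A B p (q + 1) (n + 1) (by omega) ≫ (_ ◁ B.δ i.succ) :=
    δ_frontBack_of_gt A B h _ _ (by simp; omega) (by simp)
  simp only [e1, e2, Fin.val_cast, Fin.val_castAdd, Fin.val_natAdd, Fin.val_castSucc, Fin.val_last,
    Fin.val_succ, smul_smul, Fin.val_zero, pow_zero, mul_one]
  have e3 (i : Fin (q + 1)) : (-1 : R) ^ p * (-1) ^ ((i : ℕ) + 1) = (-1) ^ (p + 1 + (i : ℕ)) := by
    ring
  simp only [e3]
  rw [pow_succ (-1 : R) p]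
  module

/-- The component of the Alexander--Whitney map in arbitrary degrees, which vanishes unless
`p + q = n`. -/
def AWn (p q n : ℕ) : ((normalization R).obj (A ⊗ B)).X n ⟶
      ((normalization R).obj A).X p ⊗ ((normalization R).obj B).X q :=
  if h : p + q = n then AW A B p q n h else 0

lemma AW_eq (p q n : ℕ) (h : p + q = n) : AW A B p q n h =
    normIncl (A ⊗ B) n ≫ frontBack A B p q n h ≫ (normProj A p ⊗ₘ normProj B q) := rfl

lemma d_AW (p q n : ℕ) (h : p + q = n) : ((normalization R).obj (A ⊗ B)).d (n + 1) n ≫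
    AW A B p q n h =
      AW A B (p + 1) q (n + 1) (by omega) ≫ (((normalization R).obj A).d (p + 1) p ▷ _) +
      (-1 : R) ^ p • (AW A B p (q + 1) (n + 1) (by omega) ≫
        (_ ◁ ((normalization R).obj B).d (q + 1) q)) := by
  rw [AW_eq, ← reassoc_of% @normIncl_alternatingD]
  slice_lhs 2 3 => rw [alternatingD_frontBack]
  simp only [AW_eq, Preadditive.add_comp, Preadditive.comp_add, Linear.smul_comp,
    Linear.comp_smul, Category.assoc]
  congr 3
  · rw [← tensorHom_id, tensorHom_comp_tensorHom, ← tensorHom_id, tensorHom_comp_tensorHom,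
      alternatingD_normProj, Category.id_comp, Category.comp_id]
  · rw [← id_tensorHom, tensorHom_comp_tensorHom, ← id_tensorHom, tensorHom_comp_tensorHom,
      alternatingD_normProj, Category.id_comp, Category.comp_id]

lemma d_AWn (p q n : ℕ) : ((normalization R).obj (A ⊗ B)).d (n + 1) n ≫ AWn A B p q n =
    AWn A B (p + 1) q (n + 1) ≫ (((normalization R).obj A).d (p + 1) p ▷ _) +
      (-1 : R) ^ p • (AWn A B p (q + 1) (n + 1) ≫ (_ ◁ ((normalization R).obj B).d (q + 1) q)) := by
  by_cases h : p + q = n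
  · rw [AWn, AWn, AWn, dif_pos h, dif_pos (by omega), dif_pos (by omega), d_AW]
  · rw [AWn, AWn, AWn, dif_neg h, dif_neg (by omega), dif_neg (by omega)]
    simp

variable {A B} in
lemma normMap_AWn {A' B' : SimplicialObject (ModuleCat.{u} R)} (f : A ⟶ A') (g : B ⟶ B')
    (p q n : ℕ) : ((normalization R).map (f ⊗ₘ g)).f n ≫ AWn A' B' p q n =
      AWn A B p q n ≫ (((normalization R).map f).f p ⊗ₘ ((normalization R).map g).f q) := by
  by_cases h : p + q = n
  · rw [AWn, AWn, dif_pos h, dif_pos h, AW_eq, AW_eq, reassoc_of% @normMap_normIncl]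
    simp only [Category.assoc]
    congr 1
    have h1 : (f ⊗ₘ g).app (op ⦋n⦌) ≫ frontBack A' B' p q n h =
        frontBack A B p q n h ≫ (f.app _ ⊗ₘ g.app _) := by
      refine (tensorHom_comp_tensorHom _ _ _ _).trans
        (Eq.trans ?_ (tensorHom_comp_tensorHom _ _ _ _).symm)
      rw [f.naturality, g.naturality]
    rw [← Category.assoc, h1, Category.assoc, tensorHom_comp_tensorHom, tensorHom_comp_tensorHom,
      app_normProj, app_normProj]
  · rw [AWn, AWn, dif_neg h, dif_neg h, Limits.zero_comp, Limits.comp_zero]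

end

section

/-! ### Signs of shuffles -/

lemma card_filter_lt_self {n : ℕ} (μ : Finset (Fin n)) :
    2 * ((μ ×ˢ μ).filter fun x => x.2 < x.1).card + μ.card = μ.card * μ.card := by
  have h1 : ((μ ×ˢ μ).filter fun x => x.1 < x.2).card =
      ((μ ×ˢ μ).filter fun x => x.2 < x.1).card :=
    Finset.card_nbij' Prod.swap Prod.swap (fun x hx => by simp at hx ⊢; tauto)
      (fun x hx => by simp at hx ⊢; tauto) (fun _ _ => rfl) (fun _ _ => rfl)
  have h2 : ((μ ×ˢ μ).filter fun x => x.1 = x.2).card = μ.card :=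
    Finset.card_nbij' Prod.fst (fun x => (x, x)) (fun x hx => by simp at hx ⊢; tauto)
      (fun x hx => by simp at hx ⊢; tauto)
      (fun x hx => Prod.ext rfl (by simp at hx ⊢; tauto)) (fun _ _ => rfl)
  have h3 := Finset.card_filter_add_card_filter_not (s := μ ×ˢ μ) (fun x => x.2 < x.1)
  have h4 := Finset.card_filter_add_card_filter_not (s := (μ ×ˢ μ).filter fun x => ¬ x.2 < x.1)
    (fun x => x.1 = x.2)
  rw [Finset.filter_filter, Finset.filter_filter] at h4
  have h5 : ((μ ×ˢ μ).filter fun x => ¬ x.2 < x.1 ∧ x.1 = x.2) =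
      ((μ ×ˢ μ).filter fun x => x.1 = x.2) := by
    apply Finset.filter_congr
    intro x _
    constructor
    · exact fun h => h.2
    · exact fun h => ⟨by rw [h]; exact lt_irrefl _, h⟩
  have h6 : ((μ ×ˢ μ).filter fun x => ¬ x.2 < x.1 ∧ ¬ x.1 = x.2) =
      ((μ ×ˢ μ).filter fun x => x.1 < x.2) := by
    apply Finset.filter_congr
    intro x _
    rw [not_lt]
    exact ⟨fun h => lt_of_le_of_ne h.1 h.2, fun h => ⟨h.le, h.ne⟩⟩
  rw [h5, h6, h1, h2] at h4
  rw [Finset.card_product] at h3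
  omega

/-- Each `x ∈ μ` has exactly `x` elements of `Fin n` below it, sorted here by membership in `μ`.
With `card_filter_lt_self` this makes the number of inversions a function of the sum and the
cardinality of `μ`, which is how all shuffle signs are compared. -/
lemma inversions_add_card_filter_lt {n : ℕ} (μ : Finset (Fin n)) :
    inversions μ + ((μ ×ˢ μ).filter fun x => x.2 < x.1).card = ∑ x ∈ μ, (x : ℕ) := by
  have h : ∑ x ∈ μ, (x : ℕ) = ((μ ×ˢ Finset.univ).filter fun x => x.2 < x.1).card := by
    rw [Finset.card_filter, Finset.sum_product]
    refine Finset.sum_congr rfl fun x _ => ?_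
    rw [← Finset.card_filter]
    rw [← Fin.card_Iio x]
    congr 1
    ext
    simp
  rw [h, inversions, ← Finset.card_union_of_disjoint]
  · congr 1
    ext x
    simp only [Finset.mem_union, Finset.mem_filter, Finset.mem_product, Finset.mem_compl,
      Finset.mem_univ]
    tauto
  · rw [Finset.disjoint_left]
    simp only [Finset.mem_filter, Finset.mem_product, Finset.mem_compl]
    tauto

/-- Twice the number of inversions in terms of the sum of the elements. -/
lemma two_mul_inversions {n : ℕ} (μ : Finset (Fin n)) :
    2 * inversions μ + μ.card * μ.card = 2 * ∑ x ∈ μ, (x : ℕ) + μ.card := by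
  have h1 := card_filter_lt_self μ
  have h2 := inversions_add_card_filter_lt μ
  omega

/-- The subset of `Fin (n + 1)` obtained by shifting by one. -/
def shiftSet {n : ℕ} (μ : Finset (Fin n)) : Finset (Fin (n + 1)) := μ.map (Fin.succEmb n)

lemma zero_notMem_shiftSet {n : ℕ} (μ : Finset (Fin n)) : 0 ∉ shiftSet μ := by
  simp [shiftSet, Fin.succ_ne_zero]

lemma succ_mem_shiftSet {n : ℕ} (μ : Finset (Fin n)) (x : Fin n) : x.succ ∈ shiftSet μ ↔ x ∈ μ := by
  simp [shiftSet]

lemma card_shiftSet {n : ℕ} (μ : Finset (Fin n)) : (shiftSet μ).card = μ.card := by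
  simp [shiftSet]

lemma card_insert_shiftSet {n : ℕ} (μ : Finset (Fin n)) :
    (insert 0 (shiftSet μ)).card = μ.card + 1 := by
  rw [Finset.card_insert_of_notMem (zero_notMem_shiftSet μ), card_shiftSet]

lemma compl_shiftSet {n : ℕ} (μ : Finset (Fin n)) : (shiftSet μ)ᶜ = insert 0 (shiftSet μᶜ) := by
  ext x
  refine Fin.cases ?_ (fun x => ?_) x
  · simp [zero_notMem_shiftSet]
  · simp [succ_mem_shiftSet, Fin.succ_ne_zero]

lemma compl_insert_shiftSet {n : ℕ} (μ : Finset (Fin n)) :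
    (insert 0 (shiftSet μ))ᶜ = shiftSet μᶜ := by
  rw [compl_eq_comm, compl_shiftSet, compl_compl]

lemma sum_shiftSet {n : ℕ} (μ : Finset (Fin n)) :
    ∑ x ∈ shiftSet μ, (x : ℕ) = ∑ x ∈ μ, (x : ℕ) + μ.card := by
  simp [shiftSet, Finset.sum_add_distrib]

lemma inversions_shiftSet {n : ℕ} (μ : Finset (Fin n)) :
    inversions (shiftSet μ) = inversions μ + μ.card := by
  have h1 := two_mul_inversions μ
  have h2 := two_mul_inversions (shiftSet μ)
  rw [card_shiftSet, sum_shiftSet] at h2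
  omega

lemma inversions_insert_shiftSet {n : ℕ} (μ : Finset (Fin n)) :
    inversions (insert 0 (shiftSet μ)) = inversions μ := by
  have h1 := two_mul_inversions μ
  have h2 := two_mul_inversions (insert 0 (shiftSet μ))
  rw [card_insert_shiftSet, Finset.sum_insert (zero_notMem_shiftSet μ), sum_shiftSet] at h2
  simp only [Fin.val_zero, zero_add] at h2
  have h3 : (μ.card + 1) * (μ.card + 1) = μ.card * μ.card + 2 * μ.card + 1 := by ring
  omega

/-- Swapping two consecutive elements, one of which belongs to `μ`. -/
def swapSet {n : ℕ} (k : Fin n) (μ : Finset (Fin (n + 1))) : Finset (Fin (n + 1)) :=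
  μ.map (Equiv.swap k.castSucc k.succ).toEmbedding

lemma mem_swapSet {n : ℕ} (k : Fin n) (μ : Finset (Fin (n + 1))) (x : Fin (n + 1)) :
    x ∈ swapSet k μ ↔ Equiv.swap k.castSucc k.succ x ∈ μ := by
  rw [swapSet, Finset.mem_map_equiv, Equiv.symm_swap]

lemma card_swapSet {n : ℕ} (k : Fin n) (μ : Finset (Fin (n + 1))) :
    (swapSet k μ).card = μ.card := Finset.card_map _

lemma compl_swapSet {n : ℕ} (k : Fin n) (μ : Finset (Fin (n + 1))) :
    (swapSet k μ)ᶜ = swapSet k μᶜ := by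
  ext x
  simp [mem_swapSet]

lemma swapSet_swapSet {n : ℕ} (k : Fin n) (μ : Finset (Fin (n + 1))) :
    swapSet k (swapSet k μ) = μ := by
  ext x
  simp [mem_swapSet]

/-- The swap raises one element of `μ` by one, so the sum grows by one at fixed cardinality. -/
lemma inversions_swapSet {n : ℕ} (k : Fin n) (μ : Finset (Fin (n + 1)))
    (h1 : k.castSucc ∈ μ) (h2 : k.succ ∉ μ) :
    inversions (swapSet k μ) = inversions μ + 1 := by
  have e1 := two_mul_inversions μ
  have e2 := two_mul_inversions (swapSet k μ)
  have e3 : ∑ x ∈ swapSet k μ, (x : ℕ) = ∑ x ∈ μ, (x : ℕ) + 1 := by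
    rw [swapSet, Finset.sum_map, ← Finset.add_sum_erase _ _ h1, ← Finset.add_sum_erase μ _ h1]
    have : ∀ x ∈ μ.erase k.castSucc, (Equiv.swap k.castSucc k.succ x : ℕ) = x := by
      intro x hx
      rw [Finset.mem_erase] at hx
      rw [Equiv.swap_apply_of_ne_of_ne hx.1 (by rintro rfl; exact h2 hx.2)]
    simp only [Equiv.coe_toEmbedding]
    rw [Finset.sum_congr rfl this]
    simp
    ring
  rw [card_swapSet, e3] at e2
  omega

lemma neg_one_pow_inversions_swapSet {n : ℕ} (k : Fin n) (μ : Finset (Fin (n + 1)))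
    (h : ¬ (k.castSucc ∈ μ ↔ k.succ ∈ μ)) :
    (-1 : R) ^ inversions (swapSet k μ) = - (-1 : R) ^ inversions μ := by
  by_cases h1 : k.castSucc ∈ μ
  · rw [inversions_swapSet k μ h1 (by tauto), pow_succ]
    ring
  · have := inversions_swapSet k (swapSet k μ) (by simp [mem_swapSet]; tauto)
      (by simpa [mem_swapSet] using h1)
    rw [swapSet_swapSet] at this
    rw [this, pow_succ]
    ring

/-! ### Faces of step maps -/

lemma stepMap_apply {n k : ℕ} (μ : Finset (Fin n)) (h : μ.card = k) (x : Fin (n + 1)) :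
    ((stepMap μ h).toOrderHom x : ℕ) = (μ.filter fun j : Fin n => (j : ℕ) < x).card := rfl

lemma card_filter_insert_shiftSet {n : ℕ} (μ : Finset (Fin n)) (x : ℕ) :
    ((insert 0 (shiftSet μ)).filter fun j : Fin (n + 1) => (j : ℕ) < x + 1).card =
      (μ.filter fun j : Fin n => (j : ℕ) < x).card + 1 := by
  rw [Finset.filter_insert, if_pos (by simp), Finset.card_insert_of_notMem
    (by simp [zero_notMem_shiftSet]), shiftSet, Finset.filter_map, Finset.card_map]
  simp

lemma card_filter_shiftSet {n : ℕ} (μ : Finset (Fin n)) (x : ℕ) :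
    ((shiftSet μ).filter fun j : Fin (n + 1) => (j : ℕ) < x + 1).card =
      (μ.filter fun j : Fin n => (j : ℕ) < x).card := by
  rw [shiftSet, Finset.filter_map, Finset.card_map]
  simp

lemma δ_zero_stepMap_shiftSet {n k : ℕ} (μ : Finset (Fin n)) (h : (shiftSet μ).card = k)
    (h' : μ.card = k) : SimplexCategory.δ 0 ≫ stepMap (shiftSet μ) h = stepMap μ h' := by
  apply simplexHom_ext
  intro x
  have h1 := δ_apply_val (0 : Fin (n + 2)) x
  rw [comp_apply_val, stepMap_apply, stepMap_apply]
  rw [show ((SimplexCategory.δ (0 : Fin (n + 2))).toOrderHom x : ℕ) = x + 1 by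
    simp only [Fin.val_zero] at h1; omega]
  exact card_filter_shiftSet μ x

lemma δ_zero_stepMap_insert {n k : ℕ} (μ : Finset (Fin n))
    (h : (insert 0 (shiftSet μ)).card = k + 1) (h' : μ.card = k) :
    SimplexCategory.δ 0 ≫ stepMap (insert 0 (shiftSet μ)) h =
      stepMap μ h' ≫ SimplexCategory.δ 0 := by
  apply simplexHom_ext
  intro x
  have h1 := δ_apply_val (0 : Fin (n + 2)) x
  have h2 := δ_apply_val (0 : Fin (k + 2)) ((stepMap μ h').toOrderHom x)
  rw [comp_apply_val, comp_apply_val, stepMap_apply]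
  rw [stepMap_apply] at h2
  rw [show ((SimplexCategory.δ (0 : Fin (n + 2))).toOrderHom x : ℕ) = x + 1 by
    simp only [Fin.val_zero] at h1; omega, card_filter_insert_shiftSet]
  simp only [Fin.val_zero] at h2
  omega

/-- The two step maps can differ only at the vertex `i + 1`, which this face omits. -/
lemma δ_stepMap_swapSet {n k : ℕ} (i : Fin n) (μ : Finset (Fin (n + 1)))
    (h : (swapSet i μ).card = k) (h' : μ.card = k) :
    SimplexCategory.δ i.succ.castSucc ≫ stepMap (swapSet i μ) h =
      SimplexCategory.δ i.succ.castSucc ≫ stepMap μ h' := by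
  apply simplexHom_ext
  intro x
  have h1 := δ_apply_val i.succ.castSucc x
  rw [comp_apply_val, comp_apply_val, stepMap_apply, stepMap_apply, swapSet, Finset.filter_map,
    Finset.card_map]
  congr 1
  apply Finset.filter_congr
  intro j _
  simp only [Function.comp_apply, Equiv.coe_toEmbedding]
  simp only [Fin.val_castSucc, Fin.val_succ] at h1
  by_cases hj1 : j = i.castSucc
  · subst hj1
    simp only [Equiv.swap_apply_left, Fin.val_succ, Fin.val_castSucc]
    omega
  by_cases hj2 : j = i.succ
  · subst hj2
    simp only [Equiv.swap_apply_right, Fin.val_succ, Fin.val_castSucc]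
    omega
  rw [Equiv.swap_apply_of_ne_of_ne hj1 hj2]

/-- If both steps adjacent to the vertex `i + 1` belong to `μ`, then the corresponding face of
`stepMap μ` misses a positive vertex. -/
lemma δ_stepMap_ne {n k : ℕ} (i : Fin (n + 1)) (μ : Finset (Fin (n + 1))) (h : μ.card = k)
    (hi : i ∈ μ) (hi' : ∀ j : Fin (n + 1), (j : ℕ) = i + 1 → j ∈ μ) (x : Fin (n + 1)) :
    ((SimplexCategory.δ i.succ ≫ stepMap μ h).toOrderHom x : ℕ) ≠
      (stepMap μ h).toOrderHom i.succ := by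
  have h1 := δ_apply_val i.succ x
  rw [comp_apply_val, stepMap_apply, stepMap_apply]
  simp only [Fin.val_succ] at h1 ⊢
  rcases h1 with ⟨hx, h1⟩ | ⟨hx, h1⟩
  · refine (Finset.card_lt_card ?_).ne
    rw [Finset.ssubset_iff_of_subset]
    · exact ⟨i, by simp [hi], by simp; omega⟩
    · apply Finset.monotone_filter_right
      intro j _ hj
      omega
  · refine (Finset.card_lt_card ?_).ne'
    rw [Finset.ssubset_iff_of_subset]
    · have : (i : ℕ) + 1 < n + 1 := by omega
      exact ⟨⟨i + 1, this⟩, by simp [hi' ⟨i + 1, this⟩ rfl]; omega, by simp [Fin.lt_def]⟩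
    · apply Finset.monotone_filter_right
      intro j _ hj
      omega

lemma stepMap_succ_pos {n k : ℕ} (i : Fin (n + 1)) (μ : Finset (Fin (n + 1))) (h : μ.card = k)
    (hi : i ∈ μ) : 0 < ((stepMap μ h).toOrderHom i.succ : ℕ) := by
  rw [stepMap_apply, Finset.card_pos]
  exact ⟨i, by simp [hi]⟩

/-! ### The shuffle map preserves normalized chains and commutes with the differentials. -/

variable (A B : SimplicialObject (ModuleCat.{u} R))

/-- A map missing the vertex `j` factors through `δ j`, and positive faces vanish on normalized
chains. -/
lemma normIncl_map_eq_zero {n k : ℕ} (θ : ⦋n⦌ ⟶ ⦋k⦌) (j : Fin (k + 1)) (hj : 0 < (j : ℕ))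
    (hθ : ∀ x, (θ.toOrderHom x : ℕ) ≠ j) : normIncl A k ≫ A.map θ.op = 0 := by
  obtain _ | k := k
  · omega
  · obtain ⟨θ', rfl⟩ := SimplexCategory.eq_comp_δ_of_not_surjective' θ j
      (fun x hx => hθ x (congrArg Fin.val hx))
    obtain ⟨j, rfl⟩ := Fin.exists_succ_eq.2 (show j ≠ 0 by rintro rfl; simp at hj)
    rw [op_comp, A.map_comp, ← Category.assoc]
    exact (congrArg (· ≫ A.map θ'.op) (normIncl_δ_succ A k j)).trans Limits.zero_comp

/-- The map `a ⊗ b ↦ θ^* a ⊗ η^* b`. -/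
def tensorMap {p q n : ℕ} (θ : ⦋n⦌ ⟶ ⦋p⦌) (η : ⦋n⦌ ⟶ ⦋q⦌) :
    A.obj (op ⦋p⦌) ⊗ B.obj (op ⦋q⦌) ⟶ (A ⊗ B).obj (op ⦋n⦌) := A.map θ.op ⊗ₘ B.map η.op

lemma tensorMap_map {p q n m : ℕ} (θ : ⦋n⦌ ⟶ ⦋p⦌) (η : ⦋n⦌ ⟶ ⦋q⦌) (ζ : ⦋m⦌ ⟶ ⦋n⦌) :
    tensorMap A B θ η ≫ (A ⊗ B).map ζ.op = tensorMap A B (ζ ≫ θ) (ζ ≫ η) := by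
  rw [tensorMap, tensorMap, op_comp, op_comp, A.map_comp, B.map_comp]
  exact tensorHom_comp_tensorHom _ _ _ _

lemma tensor_tensorMap {X Y : ModuleCat.{u} R} {p q n : ℕ} (f : X ⟶ A.obj (op ⦋p⦌))
    (g : Y ⟶ B.obj (op ⦋q⦌)) (θ : ⦋n⦌ ⟶ ⦋p⦌) (η : ⦋n⦌ ⟶ ⦋q⦌) :
    (f ⊗ₘ g) ≫ tensorMap A B θ η = (f ≫ A.map θ.op) ⊗ₘ (g ≫ B.map η.op) :=
  tensorHom_comp_tensorHom _ _ _ _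

lemma tensor_tensorMap_eq_zero_left {X Y : ModuleCat.{u} R} {p q n : ℕ} (f : X ⟶ A.obj (op ⦋p⦌))
    (g : Y ⟶ B.obj (op ⦋q⦌)) (θ : ⦋n⦌ ⟶ ⦋p⦌) (η : ⦋n⦌ ⟶ ⦋q⦌) (h : f ≫ A.map θ.op = 0) :
    (f ⊗ₘ g) ≫ tensorMap A B θ η = 0 := by
  rw [tensor_tensorMap, h, MonoidalPreadditive.zero_tensor]
  rfl

lemma tensor_tensorMap_eq_zero_right {X Y : ModuleCat.{u} R} {p q n : ℕ} (f : X ⟶ A.obj (op ⦋p⦌))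
    (g : Y ⟶ B.obj (op ⦋q⦌)) (θ : ⦋n⦌ ⟶ ⦋p⦌) (η : ⦋n⦌ ⟶ ⦋q⦌) (h : g ≫ B.map η.op = 0) :
    (f ⊗ₘ g) ≫ tensorMap A B θ η = 0 := by
  rw [tensor_tensorMap, h, MonoidalPreadditive.tensor_zero]
  rfl

lemma δ_whiskerRight_tensorMap {p q n : ℕ} (i : Fin (p + 2)) (θ : ⦋n⦌ ⟶ ⦋p⦌) (η : ⦋n⦌ ⟶ ⦋q⦌) :
    (A.δ i ▷ _) ≫ tensorMap A B θ η = tensorMap A B (θ ≫ SimplexCategory.δ i) η := by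
  rw [← tensorHom_id, tensor_tensorMap, tensorMap, op_comp, A.map_comp, Category.id_comp]
  rfl

lemma whiskerLeft_δ_tensorMap {p q n : ℕ} (i : Fin (q + 2)) (θ : ⦋n⦌ ⟶ ⦋p⦌) (η : ⦋n⦌ ⟶ ⦋q⦌) :
    (_ ◁ B.δ i) ≫ tensorMap A B θ η = tensorMap A B θ (η ≫ SimplexCategory.δ i) := by
  rw [← id_tensorHom, tensor_tensorMap, tensorMap, op_comp, B.map_comp, Category.id_comp]
  rfl

variable {A B} in
lemma tensorMap_app {A' B' : SimplicialObject (ModuleCat.{u} R)} (f : A ⟶ A') (g : B ⟶ B')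
    {p q n : ℕ} (θ : ⦋n⦌ ⟶ ⦋p⦌) (η : ⦋n⦌ ⟶ ⦋q⦌) :
    tensorMap A B θ η ≫ (f ⊗ₘ g).app (op ⦋n⦌) =
      (f.app _ ⊗ₘ g.app _) ≫ tensorMap A' B' θ η := by
  rw [tensor_tensorMap, ← f.naturality, ← g.naturality]
  exact tensorHom_comp_tensorHom _ _ _ _

/-- The summand of the shuffle map corresponding to `μ`; it vanishes unless `μ` has `p` elements
and its complement has `q` elements. -/
def shuffleTerm (p q n : ℕ) (μ : Finset (Fin n)) :
    A.obj (op ⦋p⦌) ⊗ B.obj (op ⦋q⦌) ⟶ (A ⊗ B).obj (op ⦋n⦌) :=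
  if h : μ.card = p ∧ μᶜ.card = q then
    (-1 : R) ^ inversions μ • tensorMap A B (stepMap μ h.1) (stepMap μᶜ h.2) else 0

lemma shuffleTerm_of_card {p q n : ℕ} (μ : Finset (Fin n)) (h : μ.card = p) (h' : μᶜ.card = q) :
    shuffleTerm A B p q n μ =
      (-1 : R) ^ inversions μ • tensorMap A B (stepMap μ h) (stepMap μᶜ h') :=
  dif_pos ⟨h, h'⟩

lemma shuffleTerm_eq_zero {p q n : ℕ} (μ : Finset (Fin n)) (h : ¬ (μ.card = p ∧ μᶜ.card = q)) :
    shuffleTerm A B p q n μ = 0 :=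
  dif_neg h

/-- The shuffle map in arbitrary degrees; it vanishes unless `p + q = n`. -/
def shuffleN (p q n : ℕ) : A.obj (op ⦋p⦌) ⊗ B.obj (op ⦋q⦌) ⟶ (A ⊗ B).obj (op ⦋n⦌) :=
  ∑ μ : Finset (Fin n), shuffleTerm A B p q n μ

lemma shuffleMap_eq (p q : ℕ) : shuffleMap A B p q = shuffleN A B p q (p + q) := by
  have h : ∀ μ : Finset (Fin (p + q)), μ ∈ Finset.univ.filter (fun μ : Finset (Fin (p + q)) =>
      μ.card = p) ↔ μ.card = p := by simp
  rw [shuffleN, ← Finset.sum_filter_of_ne (p := fun μ => μ.card = p),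
    Finset.sum_subtype _ h, shuffleMap]
  · refine Finset.sum_congr rfl fun μ _ => ?_
    exact (shuffleTerm_of_card A B μ.1 μ.2 _).symm
  · intro μ _ hμ
    by_contra h
    exact hμ (dif_neg fun h' => h h'.1)

lemma shuffleN_eq_zero {p q n : ℕ} (h : p + q ≠ n) : shuffleN A B p q n = 0 := by
  refine Finset.sum_eq_zero fun μ _ => shuffleTerm_eq_zero A B μ ?_
  rintro ⟨h1, h2⟩
  have := Finset.card_add_card_compl μ
  rw [Fintype.card_fin] at this
  omega

lemma shuffleTerm_map {p q n m : ℕ} (μ : Finset (Fin n)) (h : μ.card = p) (h' : μᶜ.card = q)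
    (θ : ⦋m⦌ ⟶ ⦋n⦌) : shuffleTerm A B p q n μ ≫ (A ⊗ B).map θ.op =
      (-1 : R) ^ inversions μ • tensorMap A B (θ ≫ stepMap μ h) (θ ≫ stepMap μᶜ h') := by
  rw [shuffleTerm_of_card A B μ h h', Linear.smul_comp, tensorMap_map]

/-- The tensor product of the inclusions of the normalized complexes. -/
def normIncl₂ (p q : ℕ) : ((normalization R).obj A).X p ⊗ ((normalization R).obj B).X q ⟶
    A.obj (op ⦋p⦌) ⊗ B.obj (op ⦋q⦌) := normIncl A p ⊗ₘ normIncl B q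

/-- If the steps before and after the vertex `k + 1` go in the same direction, deleting that vertex
makes one of the two step maps miss a positive vertex, and the corresponding tensor factor vanishes.
For the last step `hk` is vacuous. -/
lemma normIncl₂_shuffleTerm_δ_eq_zero {p q n : ℕ} (k : Fin (n + 1)) (μ : Finset (Fin (n + 1)))
    (hk : ∀ j : Fin (n + 1), (j : ℕ) = k + 1 → (j ∈ μ ↔ k ∈ μ)) :
    normIncl₂ A B p q ≫ shuffleTerm A B p q (n + 1) μ ≫ (A ⊗ B).δ k.succ = 0 := by
  by_cases h : μ.card = p ∧ μᶜ.card = q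
  · rw [SimplicialObject.δ, shuffleTerm_map A B μ h.1 h.2, Linear.comp_smul, normIncl₂]
    by_cases hkμ : k ∈ μ
    · rw [tensor_tensorMap_eq_zero_left, smul_zero]
      exact normIncl_map_eq_zero A _ _ (stepMap_succ_pos k μ h.1 hkμ)
        (δ_stepMap_ne k μ h.1 hkμ fun j hj => (hk j hj).2 hkμ)
    · have hkμ' : k ∈ μᶜ := by simpa using hkμ
      rw [tensor_tensorMap_eq_zero_right, smul_zero]
      exact normIncl_map_eq_zero B _ _ (stepMap_succ_pos k μᶜ h.2 hkμ')
        (δ_stepMap_ne k μᶜ h.2 hkμ' fun j hj => by simpa [hk j hj] using hkμ)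
  · rw [shuffleTerm_eq_zero A B μ h]
    simp only [Limits.zero_comp, Limits.comp_zero]

lemma shuffleTerm_swapSet_δ {p q n : ℕ} (i : Fin n) (μ : Finset (Fin (n + 1)))
    (hi : ¬ (i.castSucc ∈ μ ↔ i.succ ∈ μ)) :
    shuffleTerm A B p q (n + 1) (swapSet i μ) ≫ (A ⊗ B).δ i.castSucc.succ =
      - (shuffleTerm A B p q (n + 1) μ ≫ (A ⊗ B).δ i.castSucc.succ) := by
  have hc := card_swapSet i μ
  have hc' := card_swapSet i μᶜ
  by_cases h : μ.card = p ∧ μᶜ.card = q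
  · have h1 : (swapSet i μ).card = p := hc.trans h.1
    have h2 : (swapSet i μᶜ).card = q := hc'.trans h.2
    have h3 : (swapSet i μ)ᶜ.card = q := by rwa [compl_swapSet]
    rw [SimplicialObject.δ, shuffleTerm_map A B μ h.1 h.2, shuffleTerm_map A B _ h1 h3,
      neg_one_pow_inversions_swapSet i μ hi, neg_smul, Fin.succ_castSucc,
      δ_stepMap_swapSet i μ h1 h.1]
    simp only [compl_swapSet]
    rw [δ_stepMap_swapSet i μᶜ h2 h.2]
  · rw [shuffleTerm_eq_zero A B μ h, shuffleTerm_eq_zero A B _ (by rwa [compl_swapSet, hc, hc'])]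
    simp only [Limits.zero_comp, neg_zero]

/-- Sign-reversing involution: exchanging the two steps around the deleted vertex preserves the face
of the shuffle and reverses its sign. The sets fixed by the exchange have both steps in one
direction and contribute zero. -/
lemma normIncl₂_shuffleN_δ_succ (p q n : ℕ) (k : Fin (n + 1)) :
    (normIncl₂ A B p q ≫ shuffleN A B p q (n + 1)) ≫ (A ⊗ B).δ k.succ = 0 := by
  rw [shuffleN, Category.assoc, Preadditive.sum_comp, Preadditive.comp_sum]
  refine Fin.lastCases ?_ (fun i => ?_) k
  · refine Finset.sum_eq_zero fun μ _ => normIncl₂_shuffleTerm_δ_eq_zero A B _ μ ?_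
    intro j hj
    simp at hj
    omega
  · have h0 (μ : Finset (Fin (n + 1))) (h : i.castSucc ∈ μ ↔ i.succ ∈ μ) :
        normIncl₂ A B p q ≫ shuffleTerm A B p q (n + 1) μ ≫ (A ⊗ B).δ i.castSucc.succ = 0 := by
      refine normIncl₂_shuffleTerm_δ_eq_zero A B _ μ fun j hj => ?_
      obtain rfl : j = i.succ := Fin.ext hj
      exact h.symm
    refine Finset.sum_involution (fun μ _ => swapSet i μ) (fun μ _ => ?_) (fun μ _ hμ h => ?_)
      (fun _ _ => Finset.mem_univ _) (fun μ _ => swapSet_swapSet i μ)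
    · by_cases h : i.castSucc ∈ μ ↔ i.succ ∈ μ
      · rw [h0 μ h, h0 _ (by simpa [mem_swapSet] using h.symm), add_zero]
      · rw [shuffleTerm_swapSet_δ A B i μ h, Preadditive.comp_neg, add_neg_cancel]
    · refine hμ (h0 μ ?_)
      conv_lhs => rw [← h]
      simp [mem_swapSet]

/-- The component of the Eilenberg--Zilber map in arbitrary degrees, which vanishes unless
`p + q = n`. -/
def EZn (p q n : ℕ) : ((normalization R).obj A).X p ⊗ ((normalization R).obj B).X q ⟶
      ((normalization R).obj (A ⊗ B)).X n :=
  normIncl₂ A B p q ≫ shuffleN A B p q n ≫ normProj (A ⊗ B) n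

lemma EZ_eq (p q : ℕ) : EZ A B p q = EZn A B p q (p + q) := by
  rw [EZn, ← shuffleMap_eq]
  rfl

lemma EZn_eq_zero {p q n : ℕ} (h : p + q ≠ n) : EZn A B p q n = 0 := by
  rw [EZn, shuffleN_eq_zero A B h]
  simp only [Limits.zero_comp, Limits.comp_zero]

/-- The shuffle sum of normalized chains is already normalized, so the projection in `EZn` is
harmless. As `normIncl` is mono, identities for `EZn` can be checked on plain shuffle sums. -/
lemma EZn_normIncl (p q n : ℕ) : EZn A B p q n ≫ normIncl (A ⊗ B) n =
    normIncl₂ A B p q ≫ shuffleN A B p q n := by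
  rw [EZn, Category.assoc, Category.assoc, ← Category.assoc (normIncl₂ A B p q)]
  obtain _ | n := n
  · rw [normProj_normIncl_zero, Category.comp_id]
  · exact normProj_normIncl_of_vanish _ _ _ (normIncl₂_shuffleN_δ_succ A B p q n)

lemma sum_finset_fin_succ {M : Type*} [AddCommMonoid M] {n : ℕ} (f : Finset (Fin (n + 1)) → M) :
    ∑ μ, f μ = ∑ μ, f (insert 0 (shiftSet μ)) + ∑ μ, f (shiftSet μ) := by
  rw [← Finset.sum_filter_add_sum_filter_not Finset.univ (fun μ => (0 : Fin (n + 1)) ∈ μ)]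
  have h (μ : Finset (Fin n)) : (Finset.univ.filter fun x : Fin n => x.succ ∈ shiftSet μ) = μ := by
    ext x
    simp [succ_mem_shiftSet]
  congr 1
  · refine Finset.sum_nbij' (fun μ => Finset.univ.filter fun x : Fin n => x.succ ∈ μ)
      (fun μ => insert 0 (shiftSet μ)) (by simp) (by simp) (fun μ hμ => ?_) (fun μ _ => ?_)
      (fun μ hμ => ?_)
    · ext x
      refine Fin.cases ?_ (fun x => ?_) x
      · simpa using hμ
      · simp [succ_mem_shiftSet, Fin.succ_ne_zero]
    · ext x
      simp [succ_mem_shiftSet, Fin.succ_ne_zero]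
    · congr 1
      ext x
      refine Fin.cases ?_ (fun x => ?_) x
      · simpa using hμ
      · simp [succ_mem_shiftSet, Fin.succ_ne_zero]
  · refine Finset.sum_nbij' (fun μ => Finset.univ.filter fun x : Fin n => x.succ ∈ μ)
      (fun μ => shiftSet μ) (by simp) (by simp [zero_notMem_shiftSet]) (fun μ hμ => ?_)
      (fun μ _ => h μ) (fun μ hμ => ?_)
    · ext x
      refine Fin.cases ?_ (fun x => ?_) x
      · simpa [zero_notMem_shiftSet] using hμ
      · simp [succ_mem_shiftSet]
    · congr 1
      ext x
      refine Fin.cases ?_ (fun x => ?_) x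
      · simpa [zero_notMem_shiftSet] using hμ
      · simp [succ_mem_shiftSet]

lemma shuffleTerm_insert_δ_zero (p q n : ℕ) (μ : Finset (Fin n)) :
    shuffleTerm A B (p + 1) q (n + 1) (insert 0 (shiftSet μ)) ≫ (A ⊗ B).δ 0 =
      (A.δ 0 ▷ _) ≫ shuffleTerm A B p q n μ := by
  by_cases h : μ.card = p ∧ μᶜ.card = q
  · have h1 := (card_insert_shiftSet μ).trans (congrArg (· + 1) h.1)
    have h2 : (insert 0 (shiftSet μ))ᶜ.card = q := by rw [compl_insert_shiftSet, card_shiftSet, h.2]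
    have h2' : (shiftSet μᶜ).card = q := by rw [card_shiftSet, h.2]
    rw [SimplicialObject.δ, shuffleTerm_map A B _ h1 h2, inversions_insert_shiftSet,
      δ_zero_stepMap_insert μ h1 h.1, shuffleTerm_of_card A B μ h.1 h.2, Linear.comp_smul,
      δ_whiskerRight_tensorMap]
    simp only [compl_insert_shiftSet]
    rw [δ_zero_stepMap_shiftSet μᶜ h2' h.2]
  · rw [shuffleTerm_eq_zero A B μ h, shuffleTerm_eq_zero]
    · simp only [Limits.zero_comp, Limits.comp_zero]
    · rw [compl_insert_shiftSet, card_shiftSet, card_insert_shiftSet]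
      omega

lemma shuffleTerm_shiftSet_δ_zero (p q n : ℕ) (μ : Finset (Fin n)) :
    shuffleTerm A B p (q + 1) (n + 1) (shiftSet μ) ≫ (A ⊗ B).δ 0 =
      (-1 : R) ^ p • ((_ ◁ B.δ 0) ≫ shuffleTerm A B p q n μ) := by
  by_cases h : μ.card = p ∧ μᶜ.card = q
  · have h1 := (card_insert_shiftSet μᶜ).trans (congrArg (· + 1) h.2)
    have h1' : (shiftSet μ)ᶜ.card = q + 1 := by rw [compl_shiftSet, h1]
    have h2 : (shiftSet μ).card = p := by rw [card_shiftSet, h.1]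
    rw [SimplicialObject.δ, shuffleTerm_map A B _ h2 h1', inversions_shiftSet,
      δ_zero_stepMap_shiftSet μ h2 h.1, shuffleTerm_of_card A B μ h.1 h.2, Linear.comp_smul,
      whiskerLeft_δ_tensorMap, smul_smul,
      show (-1 : R) ^ (inversions μ + μ.card) = (-1) ^ p * (-1) ^ inversions μ by
        rw [h.1, pow_add, mul_comm]]
    simp only [compl_shiftSet]
    rw [δ_zero_stepMap_insert μᶜ h1 h.2]
  · rw [shuffleTerm_eq_zero A B μ h, shuffleTerm_eq_zero]
    · simp only [Limits.zero_comp, Limits.comp_zero, smul_zero]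
    · rw [compl_shiftSet, card_shiftSet, card_insert_shiftSet]
      omega

/-- On normalized chains the differential is `d_0`, so only the first step of each shuffle matters.
If it belongs to `μ`, the face falls on the first factor with no change of sign. Otherwise it falls
on the second, and the removed step formed an inversion with each of the `p` elements of `μ`, whence
`(-1)^p`. -/
lemma EZn_d (p q n : ℕ) : EZn A B p q (n + 1) ≫ ((normalization R).obj (A ⊗ B)).d (n + 1) n =
    (((normalization R).obj A).d p (p - 1) ▷ _) ≫ EZn A B (p - 1) q n +
      (-1 : R) ^ p • ((_ ◁ ((normalization R).obj B).d q (q - 1)) ≫ EZn A B p (q - 1) n) := by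
  rw [← cancel_mono (normIncl _ _), Category.assoc, d_normIncl, reassoc_of% @EZn_normIncl, shuffleN,
    sum_finset_fin_succ, Preadditive.add_comp, Preadditive.comp_add, Preadditive.add_comp,
    Linear.smul_comp, Category.assoc, EZn_normIncl, Category.assoc, EZn_normIncl]
  congr 1
  -- For `p = 0` both sides vanish: no set of cardinality 0 contains `0`, and `d 0 (0 - 1)` is `d 0
  -- 0 = 0`.
  · obtain _ | p := p
    · rw [Finset.sum_eq_zero, HomologicalComplex.shape _ _ _ (by simp)]
      · simp only [Limits.zero_comp, Limits.comp_zero, MonoidalPreadditive.zero_whiskerRight]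
      · refine fun μ _ => shuffleTerm_eq_zero A B _ ?_
        simp [card_insert_shiftSet]
    · rw [Preadditive.sum_comp]
      simp only [shuffleTerm_insert_δ_zero]
      rw [← Preadditive.comp_sum, ← shuffleN, ← Category.assoc, ← Category.assoc]
      congr 1
      rw [normIncl₂, normIncl₂, ← tensorHom_id, tensorHom_comp_tensorHom, ← tensorHom_id,
        tensorHom_comp_tensorHom, Category.id_comp, Category.comp_id]
      exact congrArg (· ⊗ₘ normIncl B q) (d_normIncl A p).symm
  · obtain _ | q := q
    · rw [Finset.sum_eq_zero, HomologicalComplex.shape _ _ _ (by simp)]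
      · simp only [Limits.zero_comp, Limits.comp_zero, MonoidalPreadditive.whiskerLeft_zero,
          smul_zero]
      · refine fun μ _ => shuffleTerm_eq_zero A B _ ?_
        simp [compl_shiftSet, card_insert_shiftSet]
    · rw [Preadditive.sum_comp]
      simp only [shuffleTerm_shiftSet_δ_zero]
      rw [← Finset.smul_sum, ← Preadditive.comp_sum, ← shuffleN, Linear.comp_smul,
        ← Category.assoc, ← Category.assoc]
      congr 2
      rw [normIncl₂, normIncl₂, ← id_tensorHom, tensorHom_comp_tensorHom, ← id_tensorHom,
        tensorHom_comp_tensorHom, Category.id_comp, Category.comp_id]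
      exact congrArg (normIncl A p ⊗ₘ ·) (d_normIncl B q).symm

variable {A B} in
lemma EZn_normMap {A' B' : SimplicialObject (ModuleCat.{u} R)} (f : A ⟶ A') (g : B ⟶ B')
    (p q n : ℕ) : EZn A B p q n ≫ ((normalization R).map (f ⊗ₘ g)).f n =
      (((normalization R).map f).f p ⊗ₘ ((normalization R).map g).f q) ≫ EZn A' B' p q n := by
  have h : shuffleN A B p q n ≫ (f ⊗ₘ g).app (op ⦋n⦌) =
      (f.app _ ⊗ₘ g.app _) ≫ shuffleN A' B' p q n := by
    rw [shuffleN, shuffleN, Preadditive.sum_comp, Preadditive.comp_sum]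
    refine Finset.sum_congr rfl fun μ _ => ?_
    by_cases h : μ.card = p ∧ μᶜ.card = q
    · rw [shuffleTerm_of_card A B μ h.1 h.2, shuffleTerm_of_card A' B' μ h.1 h.2,
        Linear.smul_comp, Linear.comp_smul, tensorMap_app]
    · rw [shuffleTerm_eq_zero A B μ h, shuffleTerm_eq_zero A' B' μ h, Limits.zero_comp,
        Limits.comp_zero]
  rw [EZn, EZn, Category.assoc, Category.assoc, ← app_normProj, reassoc_of% h, normIncl₂,
    normIncl₂, tensorHom_comp_tensorHom_assoc, tensorHom_comp_tensorHom_assoc, normMap_normIncl,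
    normMap_normIncl]

end

/-! ### Eilenberg–Zilber followed by Alexander–Whitney is the identity. -/

section

lemma card_filter_le_lt {n : ℕ} (a b : ℕ) (hb : b ≤ n) :
    ((Finset.univ : Finset (Fin n)).filter fun j : Fin n => a ≤ (j : ℕ) ∧ (j : ℕ) < b).card =
      b - a := by
  rw [← Nat.card_Ico, ← Finset.card_map Fin.valEmbedding]
  congr 1
  ext x
  simp only [Finset.mem_map, Finset.mem_filter, Finset.mem_univ, true_and, Fin.valEmbedding_apply,
    Finset.mem_Ico]
  constructor
  · rintro ⟨j, h, rfl⟩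
    exact h
  · intro h
    exact ⟨⟨x, by omega⟩, h, rfl⟩

/-- The shuffle whose first `p` steps are in the first direction. -/
def frontSet (p n : ℕ) : Finset (Fin n) := Finset.univ.filter fun j : Fin n => (j : ℕ) < p

lemma mem_frontSet {p n : ℕ} (j : Fin n) : j ∈ frontSet p n ↔ (j : ℕ) < p := by
  simp [frontSet]

lemma card_frontSet {p n : ℕ} (h : p ≤ n) : (frontSet p n).card = p := by
  have := card_filter_le_lt 0 p h
  simpa [frontSet] using this

lemma inversions_frontSet (p n : ℕ) : inversions (frontSet p n) = 0 := by
  rw [inversions, Finset.card_eq_zero, Finset.filter_eq_empty_iff]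
  intro x hx
  rw [Finset.mem_product, Finset.mem_compl, mem_frontSet, mem_frontSet] at hx
  rw [Fin.lt_def]
  omega

lemma front_stepMap_frontSet {p n : ℕ} (h : p ≤ n) :
    SimplexCategory.subinterval 0 p (by omega) ≫ stepMap (frontSet p n) (card_frontSet h) =
      𝟙 _ := by
  apply simplexHom_ext
  intro x
  rw [comp_apply_val, stepMap_apply, subinterval_apply_val, frontSet, Finset.filter_filter]
  have hx : (x : ℕ) < p + 1 := x.2
  refine Eq.trans ?_ (card_filter_le_lt 0 (x : ℕ) (n := n) (by omega))
  congr 1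
  apply Finset.filter_congr
  intro j _
  omega

lemma back_stepMap_frontSet {p q n : ℕ} (h : p + q = n) (h' : (frontSet p n)ᶜ.card = q) :
    SimplexCategory.subinterval p q (by omega) ≫ stepMap (frontSet p n)ᶜ h' = 𝟙 _ := by
  apply simplexHom_ext
  intro x
  rw [comp_apply_val, stepMap_apply, subinterval_apply_val]
  have hx : (x : ℕ) < q + 1 := x.2
  refine Eq.trans ?_ ((card_filter_le_lt p (x + p : ℕ) (n := n) (by omega)).trans (by simp))
  congr 1
  ext j
  simp only [Finset.mem_filter, Finset.mem_compl, mem_frontSet, Finset.mem_univ, true_and]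
  omega

lemma stepMap_castSucc_of_notMem {n k : ℕ} (μ : Finset (Fin n)) (h : μ.card = k) (j : Fin n)
    (hj : j ∉ μ) : (stepMap μ h).toOrderHom j.castSucc = (stepMap μ h).toOrderHom j.succ := by
  apply Fin.ext
  rw [stepMap_apply, stepMap_apply]
  congr 1
  apply Finset.filter_congr
  intro i hi
  have : (i : ℕ) ≠ j := fun h => hj (by rwa [← Fin.ext h])
  simp only [Fin.val_castSucc, Fin.val_succ]
  omega

/-- A step outside `μ` joins two consecutive vertices with the same image, so injectivity on an
interval forces all of its steps into `μ`. -/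
lemma mem_of_injective_subinterval_stepMap {n k p q : ℕ} (μ : Finset (Fin n)) (h : μ.card = k)
    (hpq : p + q ≤ n) (hinj : Function.Injective
      (SimplexCategory.subinterval p q hpq ≫ stepMap μ h).toOrderHom)
    (j : Fin n) (h1 : p ≤ j) (h2 : (j : ℕ) < p + q) : j ∈ μ := by
  by_contra hj
  have h3 := stepMap_castSucc_of_notMem μ h j hj
  have e (x : Fin (q + 1)) (y : Fin (n + 1)) (hxy : (x : ℕ) + p = y) :
      (SimplexCategory.subinterval p q hpq ≫ stepMap μ h).toOrderHom x =
        (stepMap μ h).toOrderHom y :=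
    congrArg (stepMap μ h).toOrderHom (Fin.ext hxy)
  have h4 := hinj ((e ⟨j - p, by omega⟩ j.castSucc (by simp; omega)).trans (h3.trans
    (e ⟨j + 1 - p, by omega⟩ j.succ (by simp; omega)).symm))
  have := congrArg Fin.val h4
  simp only at this
  omega

lemma eq_frontSet_of_injective {n k l p q : ℕ} (μ : Finset (Fin n)) (h : μ.card = k)
    (h' : μᶜ.card = l) (hpq : p + q = n)
    (h1 : Function.Injective
      (SimplexCategory.subinterval 0 p (by omega) ≫ stepMap μ h).toOrderHom)
    (h2 : Function.Injective
      (SimplexCategory.subinterval p q (by omega) ≫ stepMap μᶜ h').toOrderHom) :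
    μ = frontSet p n := by
  ext j
  rw [mem_frontSet]
  constructor
  · intro hj
    by_contra hp
    have := mem_of_injective_subinterval_stepMap μᶜ h' _ h2 j (by omega) (by omega)
    simp only [Finset.mem_compl] at this
    exact this hj
  · intro hj
    exact mem_of_injective_subinterval_stepMap μ h _ h1 j (by omega) (by omega)

variable (A B : SimplicialObject (ModuleCat.{u} R))

lemma tensorMap_frontBack {p q p' q' n : ℕ} (h : p' + q' = n) (θ : ⦋n⦌ ⟶ ⦋p⦌) (η : ⦋n⦌ ⟶ ⦋q⦌) :
    tensorMap A B θ η ≫ frontBack A B p' q' n h =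
      A.map (SimplexCategory.subinterval 0 p' (by omega) ≫ θ).op ⊗ₘ
        B.map (SimplexCategory.subinterval p' q' (by omega) ≫ η).op := by
  rw [op_comp, op_comp, A.map_comp, B.map_comp]
  exact tensorHom_comp_tensorHom _ _ _ _

/-- For any other set, the front face in the first factor or the back face in the second is
degenerate and dies under normalization. -/
lemma shuffleTerm_frontBack_normProj {p q p' q' n : ℕ} (h : p' + q' = n) (μ : Finset (Fin n))
    (hμ : μ ≠ frontSet p' n) :
    shuffleTerm A B p q n μ ≫ frontBack A B p' q' n h ≫ (normProj A p' ⊗ₘ normProj B q') = 0 := by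
  by_cases hc : μ.card = p ∧ μᶜ.card = q
  · rw [shuffleTerm_of_card A B μ hc.1 hc.2, Linear.smul_comp, ← Category.assoc,
      tensorMap_frontBack, tensorHom_comp_tensorHom]
    by_cases h1 : Function.Injective (SimplexCategory.subinterval 0 p' (by omega) ≫
        stepMap μ hc.1).toOrderHom
    · rw [map_normProj_eq_zero B _ _ fun h2 => hμ (eq_frontSet_of_injective μ _ _ h h1 h2),
        MonoidalPreadditive.tensor_zero, smul_zero]
    · rw [map_normProj_eq_zero A _ _ h1, MonoidalPreadditive.zero_tensor, smul_zero]
  · rw [shuffleTerm_eq_zero A B μ hc, Limits.zero_comp]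

/-- The only candidate, `frontSet p' n`, has cardinality `p'` and so does not index a summand for `p
≠ p'`. -/
lemma EZn_AWn_of_ne {p q p' q' n : ℕ} (h : p ≠ p') : EZn A B p q n ≫ AWn A B p' q' n = 0 := by
  by_cases hpq : p' + q' = n
  · rw [AWn, dif_pos hpq, AW_eq, reassoc_of% @EZn_normIncl, shuffleN, Preadditive.sum_comp,
      Finset.sum_eq_zero, Limits.comp_zero]
    intro μ _
    by_cases hμ : μ = frontSet p' n
    · rw [shuffleTerm_eq_zero, Limits.zero_comp]
      rintro ⟨hc, -⟩
      rw [hμ, card_frontSet (by omega)] at hc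
      exact h hc.symm
    · exact shuffleTerm_frontBack_normProj A B hpq μ hμ
  · rw [AWn, dif_neg hpq, Limits.comp_zero]

/-- The surviving shuffle has no inversions, and its step maps are left inverse to the front and
back inclusions, so its summand is the identity. -/
lemma EZn_AWn_self {p q n : ℕ} (h : p + q = n) : EZn A B p q n ≫ AWn A B p q n = 𝟙 _ := by
  have hc := card_frontSet (p := p) (n := n) (by omega)
  have hc' : (frontSet p n)ᶜ.card = q := by
    rw [Finset.card_compl, Fintype.card_fin, hc]
    omega
  rw [AWn, dif_pos h, AW_eq, reassoc_of% @EZn_normIncl, shuffleN, Preadditive.sum_comp,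
    Finset.sum_eq_single (frontSet p n)
      (fun μ _ hμ => shuffleTerm_frontBack_normProj A B h μ hμ)
      (fun h => (h (Finset.mem_univ _)).elim),
    shuffleTerm_of_card A B _ hc hc', inversions_frontSet, pow_zero, one_smul, ← Category.assoc
      (tensorMap _ _ _ _), tensorMap_frontBack, front_stepMap_frontSet (by omega),
    back_stepMap_frontSet h, op_id, op_id, A.map_id, B.map_id, tensorHom_comp_tensorHom, normIncl₂,
    tensorHom_comp_tensorHom, Category.id_comp, Category.id_comp, normIncl_normProj,
    normIncl_normProj, id_tensorHom_id]

end

section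

/-! ### Pairings of chain complexes -/

/-- The partial map `x ↦ f (x ⊗ k)` of a map `f` out of a tensor product, linear in `k`. -/
def partialMap {X K Y : ModuleCat.{u} R} (f : X ⊗ K ⟶ Y) : K →ₗ[R] (X ⟶ Y) where
  toFun k := ModuleCat.ofHom (f.hom ∘ₗ (TensorProduct.mk R X K).flip k)
  map_add' k l := by rw [map_add, LinearMap.comp_add]; rfl
  map_smul' r k := by rw [map_smul, LinearMap.comp_smul]; rfl

section partialMap

variable {X K Y X' K' Y' : ModuleCat.{u} R}

lemma partialMap_ext {f g : X ⊗ K ⟶ Y} (h : ∀ k, partialMap f k = partialMap g k) : f = g :=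
  ModuleCat.hom_ext (TensorProduct.ext' fun x k => congrArg (fun φ => φ.hom x) (h k))

lemma partialMap_add (f g : X ⊗ K ⟶ Y) (k : K) :
    partialMap (f + g) k = partialMap f k + partialMap g k := rfl

lemma partialMap_smul (r : R) (f : X ⊗ K ⟶ Y) (k : K) :
    partialMap (r • f) k = r • partialMap f k := rfl

lemma partialMap_zero (k : K) : partialMap (0 : X ⊗ K ⟶ Y) k = 0 := rfl

lemma partialMap_comp (f : X ⊗ K ⟶ Y) (g : Y ⟶ Y') (k : K) :
    partialMap (f ≫ g) k = partialMap f k ≫ g := rfl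

lemma partialMap_whiskerRight_comp (h : X' ⟶ X) (f : X ⊗ K ⟶ Y) (k : K) :
    partialMap ((h ▷ K) ≫ f) k = h ≫ partialMap f k := rfl

lemma partialMap_whiskerLeft_comp (h : K' ⟶ K) (f : X ⊗ K ⟶ Y) (k : K') :
    partialMap ((X ◁ h) ≫ f) k = partialMap f (h.hom k) := rfl

end partialMap

lemma neg_one_pow_mul_self (n : ℕ) : (-1 : R) ^ n * (-1) ^ n = 1 := by
  rw [← mul_pow, neg_one_mul, neg_neg, one_pow]

variable {X Y K X' Y' K' : ChainComplex (ModuleCat.{u} R) ℕ}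

lemma homComplex_d_apply (n : ℕ) (f : homChains R X Y (n + 1)) :
    (((homComplex X Y).d (n + 1) n).hom f : homChains R X Y n).1 = homDiff R X Y (n + 1) f.1 := by
  have : (homComplex X Y).d (n + 1) n =
    ModuleCat.ofHom ((homDiff R X Y (n + 1)).restrict (homDiff_mem X Y n)) := by
    simp only [homComplex, ChainComplex.of_d]
  rw [this]
  rfl

/-- The family of maps `X_p ⟶ Y_n` given by the value of a map `K ⟶ Hom(X, Y)` at a chain. -/
def family (φ : K ⟶ homComplexFunctor.obj (op X, Y)) (q : ℕ) (k : K.X q) :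
    ∀ p n : ℕ, X.X p ⟶ Y.X n := ((φ.f q).hom k : homChains R X Y q).1

lemma family_mem (φ : K ⟶ homComplexFunctor.obj (op X, Y)) (q : ℕ) (k : K.X q) :
    family φ q k ∈ homChains R X Y q := ((φ.f q).hom k : homChains R X Y q).2

lemma family_zero (φ : K ⟶ homComplexFunctor.obj (op X, Y)) (q : ℕ) : family φ q 0 = 0 :=
  congrArg (fun f : homChains R X Y q => f.1) (map_zero (φ.f q).hom)

lemma family_ext {φ ψ : K ⟶ homComplexFunctor.obj (op X, Y)}
    (h : ∀ q k p n, family φ q k p n = family ψ q k p n) : φ = ψ :=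
  HomologicalComplex.hom_ext _ _ fun q => ModuleCat.hom_ext (LinearMap.ext fun k =>
    Subtype.ext (funext fun p => funext fun n => h q k p n))

lemma family_d (φ : K ⟶ homComplexFunctor.obj (op X, Y)) (q : ℕ) (k : K.X (q + 1)) :
    family φ q ((K.d (q + 1) q).hom k) = homDiff R X Y (q + 1) (family φ (q + 1) k) := by
  rw [← homComplex_d_apply q ⟨_, family_mem φ (q + 1) k⟩]
  exact congrArg (fun f => (f.hom k : homChains R X Y q).1) (φ.comm (q + 1) q).symm

lemma partialMap_chainTranspose (φ : K ⟶ homComplexFunctor.obj (op X, Y)) (p q n : ℕ) (k : K.X q) :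
    partialMap (chainTranspose φ p q n) k = (-1 : R) ^ (p * q) • family φ q k p n := rfl

lemma chainTranspose_injective {φ ψ : K ⟶ homComplexFunctor.obj (op X, Y)}
    (h : ∀ p q n, p + q = n → chainTranspose φ p q n = chainTranspose ψ p q n) : φ = ψ := by
  refine family_ext fun q k p n => ?_
  by_cases hn : p + q = n
  · have := congrArg (fun f => (-1 : R) ^ (p * q) • partialMap f k) (h p q n hn)
    simpa only [partialMap_chainTranspose, smul_smul, neg_one_pow_mul_self, one_smul] using this
  · rw [(family_mem φ q k).1 p n hn, (family_mem ψ q k).1 p n hn]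

/-- The condition that a family of maps `X_p ⊗ K_q ⟶ Y_n` is a chain map `X ⊗ K ⟶ Y`. -/
structure IsPairing (g : ∀ p q n : ℕ, X.X p ⊗ K.X q ⟶ Y.X n) : Prop where
  zero : ∀ p q n, p + q ≠ n → g p q n = 0
  comm : ∀ p q n, g p q (n + 1) ≫ Y.d (n + 1) n = (X.d p (p - 1) ▷ _) ≫ g (p - 1) q n +
    (-1 : R) ^ p • ((_ ◁ K.d q (q - 1)) ≫ g p (q - 1) n)

lemma isPairing_chainTranspose (φ : K ⟶ homComplexFunctor.obj (op X, Y)) :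
    IsPairing (chainTranspose φ) where
  zero p q n h := partialMap_ext fun k => by
    rw [partialMap_chainTranspose, (family_mem φ q k).1 p n h, smul_zero, partialMap_zero]
  comm p q n := partialMap_ext fun k => by
    rw [partialMap_comp, partialMap_add, partialMap_whiskerRight_comp, partialMap_smul,
      partialMap_whiskerLeft_comp, partialMap_chainTranspose, partialMap_chainTranspose,
      partialMap_chainTranspose]
    -- At `p = 0` the two signs may differ because of truncated subtraction, but there the
    -- differential `d 0 0` is zero.
    have hsign : (-1 : R) ^ ((p - 1) * q) • (X.d p (p - 1) ≫ family φ q k (p - 1) n) =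
        (-1 : R) ^ (p * q) • (-1 : R) ^ q • (X.d p (p - 1) ≫ family φ q k (p - 1) n) := by
      obtain _ | p := p
      · rw [X.shape _ _ (by simp), Limits.zero_comp, smul_zero, smul_zero, smul_zero]
      · rw [smul_smul, Nat.add_sub_cancel, Nat.succ_mul, pow_add, mul_assoc, neg_one_pow_mul_self,
          mul_one]
    rw [Linear.smul_comp, Linear.comp_smul, hsign]
    obtain _ | q := q
    -- In degree 0 of `K` there is no differential to use; the cycle condition of the good
    -- truncation takes its place.
    · rw [(family_mem φ 0 k).2 rfl, K.shape _ _ (by simp)]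
      simp [family_zero]
    · have h := congrFun (congrFun (family_d φ q k) p) n
      change _ = family φ (q + 1) k p (n + 1) ≫ Y.d (n + 1) n -
        (-1 : R) ^ (q + 1) • (X.d p (p - 1) ≫ family φ (q + 1) k (p - 1) n) at h
      change _ = _ + (-1 : R) ^ p • (-1 : R) ^ (p * q) • family φ q ((K.d (q + 1) q).hom k) p n
      have e : (-1 : R) ^ p * (-1) ^ (p * q) = (-1) ^ (p * (q + 1)) := by
        rw [← pow_add]
        congr 1
        ring
      rw [h, smul_smul ((-1 : R) ^ p), e]
      module

/-- The map `K ⟶ Hom(X, Y)` corresponding to a pairing. -/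
def ofPairing (g : ∀ p q n : ℕ, X.X p ⊗ K.X q ⟶ Y.X n) (hg : IsPairing g) :
    K ⟶ homComplexFunctor.obj (op X, Y) :=
  have key (p q n : ℕ) (k : K.X q) : partialMap (g p q (n + 1)) k ≫ Y.d (n + 1) n =
      X.d p (p - 1) ≫ partialMap (g (p - 1) q n) k +
        (-1 : R) ^ p • partialMap (g p (q - 1) n) ((K.d q (q - 1)).hom k) :=
    congrArg (fun f => partialMap f k) (hg.comm p q n)
  have sign (p q n : ℕ) (k : K.X q) :
      (-1 : R) ^ ((p - 1) * q) • (X.d p (p - 1) ≫ partialMap (g (p - 1) q n) k) =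
        (-1 : R) ^ (p * q) • (-1 : R) ^ q • (X.d p (p - 1) ≫ partialMap (g (p - 1) q n) k) := by
    obtain _ | p := p
    · rw [X.shape _ _ (by simp), Limits.zero_comp, smul_zero, smul_zero, smul_zero]
    · rw [smul_smul, Nat.add_sub_cancel, Nat.succ_mul, pow_add, mul_assoc, neg_one_pow_mul_self,
        mul_one]
  { f := fun q => ModuleCat.ofHom (Y := homChains R X Y q)
      (LinearMap.codRestrict (homChains R X Y q)
        (LinearMap.pi fun p => LinearMap.pi fun n => (-1 : R) ^ (p * q) • partialMap (g p q n))
        (fun k => ⟨fun p n h => by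
            simp [hg.zero p q n h, show partialMap (0 : X.X p ⊗ K.X q ⟶ Y.X n) = 0 from rfl],
          fun hq p n => by
            subst hq
            have := key p 0 n k
            -- With `d 0 0 = 0` the pairing identity becomes the cycle condition imposed in degree
            -- 0.
            rw [K.shape _ _ (by simp)] at this
            simpa using this⟩))
    comm' := fun i q h => by
      obtain rfl : q + 1 = i := h
      refine ModuleCat.hom_ext (LinearMap.ext fun k => Subtype.ext ?_)
      refine (homComplex_d_apply q _).trans ?_
      funext p n
      change ((-1 : R) ^ (p * (q + 1)) • partialMap (g p (q + 1) (n + 1)) k) ≫ Y.d (n + 1) n -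
        (-1 : R) ^ (q + 1) • (X.d p (p - 1) ≫
          ((-1 : R) ^ ((p - 1) * (q + 1)) • partialMap (g (p - 1) (q + 1) n) k)) =
        (-1 : R) ^ (p * q) • partialMap (g p q n) ((K.d (q + 1) q).hom k)
      rw [Linear.smul_comp, Linear.comp_smul, key, sign]
      simp only [smul_add, smul_smul]
      rw [mul_left_comm, neg_one_pow_mul_self, mul_one, ← pow_add,
        show p * (q + 1) + p = p * q + (p + p) by ring, pow_add _ (p * q), pow_add _ p p,
        neg_one_pow_mul_self, mul_one]
      abel }

lemma chainTranspose_ofPairing (g : ∀ p q n : ℕ, X.X p ⊗ K.X q ⟶ Y.X n) (hg : IsPairing g)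
    (p q n : ℕ) : chainTranspose (ofPairing g hg) p q n = g p q n := by
  refine partialMap_ext fun k => ?_
  rw [partialMap_chainTranspose]
  change (-1 : R) ^ (p * q) • ((-1 : R) ^ (p * q) • partialMap (g p q n) k) = _
  rw [smul_smul, neg_one_pow_mul_self, one_smul]

lemma IsPairing.comp {g : ∀ p q n : ℕ, X.X p ⊗ K.X q ⟶ Y.X n} (hg : IsPairing g) (β : Y ⟶ Y') :
    IsPairing fun p q n => g p q n ≫ β.f n where
  zero p q n h := by rw [hg.zero p q n h, Limits.zero_comp]
  comm p q n := by
    rw [Category.assoc, β.comm, ← Category.assoc, hg.comm, Preadditive.add_comp, Linear.smul_comp,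
      Category.assoc, Category.assoc]

lemma chainTranspose_precomp (κ : K' ⟶ K) (φ : K ⟶ homComplexFunctor.obj (op X, Y)) (p q n : ℕ) :
    chainTranspose (κ ≫ φ) p q n = (_ ◁ κ.f q) ≫ chainTranspose φ p q n :=
  partialMap_ext fun _ => rfl

lemma chainTranspose_map (φ : K ⟶ homComplexFunctor.obj (op X, Y)) (α : X' ⟶ X) (β : Y ⟶ Y')
    (p q n : ℕ) : chainTranspose (φ ≫ homComplexFunctor.map
      ((α.op, β) : ((op X, Y) : (ChainComplex (ModuleCat.{u} R) ℕ)ᵒᵖ × _) ⟶ (op X', Y'))) p q n =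
      (α.f p ▷ _) ≫ chainTranspose φ p q n ≫ β.f n := by
  refine partialMap_ext fun k => ?_
  rw [partialMap_chainTranspose, partialMap_whiskerRight_comp, partialMap_comp,
    partialMap_chainTranspose, Linear.smul_comp, Linear.comp_smul]
  rfl

end

section

/-! ### Pairings and the Eilenberg--Zilber and Alexander--Whitney maps -/

lemma isPairing_EZn (A B : SimplicialObject (ModuleCat.{u} R)) :
    IsPairing (X := (normalization R).obj A) (K := (normalization R).obj B)
      (Y := (normalization R).obj (A ⊗ B)) (EZn A B) :=
  ⟨fun _ _ _ h => EZn_eq_zero A B h, EZn_d A B⟩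

section awComp

variable {A K A' K' : SimplicialObject (ModuleCat.{u} R)} {Y Y' : ChainComplex (ModuleCat.{u} R) ℕ}

/-- The composite `N(A ⊗ K) ⟶ N A ⊗ N K ⟶ Y` of the Alexander--Whitney map with a pairing. -/
def awComp (g : ∀ p q n : ℕ,
      ((normalization R).obj A).X p ⊗ ((normalization R).obj K).X q ⟶ Y.X n)
    (hg : IsPairing g) : (normalization R).obj (A ⊗ K) ⟶ Y where
  f n := ∑ x ∈ Finset.HasAntidiagonal.antidiagonal n, AWn A K x.1 x.2 n ≫ g x.1 x.2 n
  comm' i n h := by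
    obtain rfl : n + 1 = i := h
    rw [Preadditive.sum_comp, Preadditive.comp_sum]
    simp only [Category.assoc, hg.comm, reassoc_of% @d_AWn, Preadditive.comp_add,
        Preadditive.add_comp,
      Finset.sum_add_distrib]
    congr 1
    -- The reindexing `p ↦ p + 1` misses only the term `p = 0`, where `d 0 0 = 0`; the other summand
    -- is treated in the same way at `q = 0`.
    · rw [Finset.Nat.sum_antidiagonal_succ, HomologicalComplex.shape _ _ _ (by simp)]
      simp
    · rw [Finset.Nat.sum_antidiagonal_succ', HomologicalComplex.shape _ _ _ (by simp)]
      simp [Linear.comp_smul, Linear.smul_comp]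

lemma awComp_f (g : ∀ p q n : ℕ,
      ((normalization R).obj A).X p ⊗ ((normalization R).obj K).X q ⟶ Y.X n)
    (hg : IsPairing g) (n : ℕ) :
    (awComp g hg).f n = ∑ x ∈ Finset.HasAntidiagonal.antidiagonal n,
      AWn A K x.1 x.2 n ≫ g x.1 x.2 n := rfl

lemma awComp_f_eq_sum_AW (g : ∀ p q n : ℕ,
      ((normalization R).obj A).X p ⊗ ((normalization R).obj K).X q ⟶ Y.X n)
    (hg : IsPairing g) (n : ℕ) :
    (awComp g hg).f n = ∑ x : Finset.HasAntidiagonal.antidiagonal n,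
      AW A K x.1.1 x.1.2 n (Finset.HasAntidiagonal.mem_antidiagonal.1 x.2) ≫ g x.1.1 x.1.2 n := by
  rw [awComp_f, ← Finset.sum_coe_sort]
  refine Finset.sum_congr rfl fun x _ => ?_
  rw [AWn, dif_pos]

lemma EZn_awComp (g : ∀ p q n : ℕ,
      ((normalization R).obj A).X p ⊗ ((normalization R).obj K).X q ⟶ Y.X n)
    (hg : IsPairing g) (p q n : ℕ) : EZn A K p q n ≫ (awComp g hg).f n = g p q n := by
  by_cases h : p + q = n
  · rw [awComp_f, Preadditive.comp_sum, Finset.sum_eq_single (p, q)]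
    · rw [← Category.assoc, EZn_AWn_self A K h, Category.id_comp]
    · rintro ⟨p', q'⟩ h1 h2
      rw [Finset.HasAntidiagonal.mem_antidiagonal] at h1
      rw [← Category.assoc, EZn_AWn_of_ne, Limits.zero_comp]
      rintro rfl
      exact h2 (Prod.ext rfl (by simp only at h1 ⊢; omega))
    · intro h1
      exact (h1 (Finset.HasAntidiagonal.mem_antidiagonal.2 h)).elim
  · rw [EZn_eq_zero A K h, hg.zero p q n h, Limits.zero_comp]

lemma awComp_comp (g : ∀ p q n : ℕ,
      ((normalization R).obj A).X p ⊗ ((normalization R).obj K).X q ⟶ Y.X n)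
    (hg : IsPairing g) (β : Y ⟶ Y') : awComp g hg ≫ β = awComp _ (hg.comp β) := by
  ext1 n
  rw [HomologicalComplex.comp_f, awComp_f, awComp_f, Preadditive.sum_comp]
  simp only [Category.assoc]

lemma map_awComp (f : A ⟶ A') (k : K ⟶ K') (g : ∀ p q n : ℕ,
      ((normalization R).obj A).X p ⊗ ((normalization R).obj K).X q ⟶ Y.X n) (hg : IsPairing g)
    (g' : ∀ p q n : ℕ,
      ((normalization R).obj A').X p ⊗ ((normalization R).obj K').X q ⟶ Y.X n) (hg' : IsPairing g')
    (h : ∀ p q n, g p q n =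
      (((normalization R).map f).f p ⊗ₘ ((normalization R).map k).f q) ≫ g' p q n) :
    (normalization R).map (f ⊗ₘ k) ≫ awComp g' hg' = awComp g hg := by
  ext1 n
  rw [HomologicalComplex.comp_f, awComp_f, awComp_f, Preadditive.comp_sum]
  refine Finset.sum_congr rfl fun x _ => ?_
  rw [reassoc_of% @normMap_AWn, h]

end awComp

end

section

/-! ### Natural contractions via décalage -/

/-- A décalage for a functor to simplicial modules: an endofunctor `D` of the source which shifts
the degrees of the simplicial modules by one, by means of a new initial vertex. -/
structure Decalage {C : Type*} [Category C] (F : C ⥤ SimplicialObject (ModuleCat.{u} R)) where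
  /-- the shift functor -/
  D : C ⥤ C
  /-- the map which deletes the initial vertex -/
  p : D ⟶ 𝟭 C
  /-- the identification of the shifted modules -/
  e (c : C) (n : ℕ) : (F.obj (D.obj c)).obj (op ⦋n⦌) ≅ (F.obj c).obj (op ⦋n + 1⦌)
  e_naturality {c c' : C} (f : c ⟶ c') (n : ℕ) :
    (F.map (D.map f)).app (op ⦋n⦌) ≫ (e c' n).hom = (e c n).hom ≫ (F.map f).app (op ⦋n + 1⦌)
  p_app (c : C) (n : ℕ) : (F.map (p.app c)).app (op ⦋n⦌) = (e c n).hom ≫ (F.obj c).δ 0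
  δ_e (c : C) (n : ℕ) (i : Fin (n + 2)) :
    (F.obj (D.obj c)).δ i ≫ (e c n).hom = (e c (n + 1)).hom ≫ (F.obj c).δ i.succ

namespace Decalage

variable {C : Type*} [Category C] {F : C ⥤ SimplicialObject (ModuleCat.{u} R)} (𝒟 : Decalage F)
  (U : ∀ (n : ℕ) (c : C), (F.obj c).obj (op ⦋n⦌) ⟶ (F.obj c).obj (op ⦋n⦌))

/-- The conjugate by the décalage of a family of operators. -/
def shift {n m : ℕ} (V : ∀ c : C, (F.obj c).obj (op ⦋n⦌) ⟶ (F.obj c).obj (op ⦋m⦌)) (c : C) :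
    (F.obj c).obj (op ⦋n + 1⦌) ⟶ (F.obj c).obj (op ⦋m + 1⦌) :=
  (𝒟.e c n).inv ≫ V (𝒟.D.obj c) ≫ (𝒟.e c m).hom

lemma shift_comp_shift {n m k : ℕ} (V : ∀ c : C, (F.obj c).obj (op ⦋n⦌) ⟶ (F.obj c).obj (op ⦋m⦌))
    (W : ∀ c : C, (F.obj c).obj (op ⦋m⦌) ⟶ (F.obj c).obj (op ⦋k⦌)) (c : C) :
    𝒟.shift V c ≫ 𝒟.shift W c = 𝒟.shift (fun c => V c ≫ W c) c := by
  simp [shift]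

lemma shift_add {n m : ℕ} (V W : ∀ c : C, (F.obj c).obj (op ⦋n⦌) ⟶ (F.obj c).obj (op ⦋m⦌)) (c : C) :
    𝒟.shift (fun c => V c + W c) c = 𝒟.shift V c + 𝒟.shift W c := by
  simp [shift]

lemma shift_zero {n m : ℕ} (c : C) :
    𝒟.shift (fun c => (0 : (F.obj c).obj (op ⦋n⦌) ⟶ (F.obj c).obj (op ⦋m⦌))) c = 0 := by
  simp [shift]

/-- This is naturality of `V` along `𝒟.p`, whose component is deletion of the added vertex. -/
lemma shift_δ_zero {n m : ℕ} (V : ∀ c : C, (F.obj c).obj (op ⦋n⦌) ⟶ (F.obj c).obj (op ⦋m⦌))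
    (hV : ∀ {c c' : C} (f : c ⟶ c'), (F.map f).app _ ≫ V c' = V c ≫ (F.map f).app _) (c : C) :
    𝒟.shift V c ≫ (F.obj c).δ 0 = (F.obj c).δ 0 ≫ V c := by
  have h := hV (𝒟.p.app c)
  rw [𝒟.p_app, 𝒟.p_app] at h
  rw [shift, Category.assoc, Category.assoc, Iso.inv_comp_eq]
  exact h.symm.trans (Category.assoc _ _ _)

lemma shift_naturality {n m : ℕ} (V : ∀ c : C, (F.obj c).obj (op ⦋n⦌) ⟶ (F.obj c).obj (op ⦋m⦌))
    (hV : ∀ {c c' : C} (f : c ⟶ c'), (F.map f).app _ ≫ V c' = V c ≫ (F.map f).app _)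
    {c c' : C} (f : c ⟶ c') :
    (F.map f).app _ ≫ 𝒟.shift V c' = 𝒟.shift V c ≫ (F.map f).app _ := by
  have h : (F.map f).app _ ≫ (𝒟.e c' n).inv = (𝒟.e c n).inv ≫ (F.map (𝒟.D.map f)).app _ := by
    rw [Iso.comp_inv_eq, Category.assoc, 𝒟.e_naturality, Iso.inv_hom_id_assoc]
  rw [shift, shift, reassoc_of% h, reassoc_of% (hV (𝒟.D.map f)), 𝒟.e_naturality]
  simp

lemma alternatingD_succ (n : ℕ) (c : C) : alternatingD (F.obj c) (n + 1) =
    (F.obj c).δ 0 - 𝒟.shift (fun c => alternatingD (F.obj c) n) c := by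
  have h (i : Fin (n + 2)) : (𝒟.e c (n + 1)).inv ≫ (F.obj (𝒟.D.obj c)).δ i ≫ (𝒟.e c n).hom =
      (F.obj c).δ i.succ := by rw [𝒟.δ_e, Iso.inv_hom_id_assoc]
  rw [alternatingD, Fin.sum_univ_succ, shift, alternatingD, Preadditive.sum_comp,
    Preadditive.comp_sum]
  simp only [Linear.smul_comp, Linear.comp_smul, h, Fin.val_zero, pow_zero, one_smul, Fin.val_succ,
    pow_succ, mul_neg, mul_one, neg_smul, Finset.sum_neg_distrib, sub_eq_add_neg]

/-- With respect to the shifted differential, `σ 0` is an extra degeneracy, hence a contraction: its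
composite with `δ 1` is the identity, and the later faces commute with it up to an index shift that
flips the sign. -/
lemma σ_shift_alternatingD (n : ℕ) (c : C) :
    (F.obj c).σ 0 ≫ 𝒟.shift (fun c => alternatingD (F.obj c) (n + 1)) c =
      𝟙 _ - 𝒟.shift (fun c => alternatingD (F.obj c) n) c ≫ (F.obj c).σ 0 := by
  have h (m : ℕ) : 𝒟.shift (fun c => alternatingD (F.obj c) m) c =
      ∑ i : Fin (m + 2), (-1 : R) ^ (i : ℕ) • (F.obj c).δ i.succ := by
    rw [shift, alternatingD, Preadditive.sum_comp, Preadditive.comp_sum]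
    simp only [Linear.smul_comp, Linear.comp_smul, 𝒟.δ_e, Iso.inv_hom_id_assoc]
  have h' (i : Fin (n + 2)) : (F.obj c).σ 0 ≫ (F.obj c).δ i.succ.succ =
      (F.obj c).δ i.succ ≫ (F.obj c).σ 0 := by
    have := (F.obj c).δ_comp_σ_of_gt (i := i.succ) (j := 0) (by simp [Fin.lt_def])
    simpa using this
  rw [h, h, Fin.sum_univ_succ, Preadditive.comp_add, Preadditive.comp_sum, Preadditive.sum_comp]
  simp only [Linear.smul_comp, Linear.comp_smul, h', Fin.val_succ, pow_succ, mul_neg, mul_one,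
    neg_smul, Preadditive.comp_neg, Finset.sum_neg_distrib, sub_eq_add_neg, Fin.val_zero,
        pow_zero, one_smul]
  congr 1
  have := (F.obj c).δ_comp_σ_succ (i := (0 : Fin (n + 3)))
  simpa using this

/-- The natural homotopy from the zero map to a natural chain endomorphism `U` of the alternating
face map complex which vanishes in degree zero. -/
def homotopy (n : ℕ) (c : C) : (F.obj c).obj (op ⦋n⦌) ⟶ (F.obj c).obj (op ⦋n + 1⦌) :=
  match n with
  | 0 => 0
  -- The first term lifts `U`: its composite with `δ 0` is `U (n + 1)`. The second corrects the
  -- error made with respect to the shifted differential.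
  | n + 1 => (F.obj c).σ 0 ≫ 𝒟.shift (U (n + 1)) c - 𝒟.shift (fun c => homotopy n c) c

variable {U}

lemma homotopy_naturality (hU : ∀ (n : ℕ) {c c' : C} (f : c ⟶ c'),
      (F.map f).app _ ≫ U n c' = U n c ≫ (F.map f).app _)
    (n : ℕ) {c c' : C} (f : c ⟶ c') :
    (F.map f).app _ ≫ 𝒟.homotopy U n c' = 𝒟.homotopy U n c ≫ (F.map f).app _ := by
  induction n generalizing c c' with
  | zero => simp [homotopy]
  | succ n ih =>
    rw [homotopy, homotopy, Preadditive.comp_sub, Preadditive.sub_comp,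
      𝒟.shift_naturality _ (fun f => ih f), Category.assoc, ← 𝒟.shift_naturality _ (hU (n + 1))]
    congr 1
    exact (NatTrans.naturality_assoc (F.map f) (SimplexCategory.σ 0).op _).symm

lemma homotopy_comp_alternatingD (hU : ∀ (n : ℕ) {c c' : C} (f : c ⟶ c'),
      (F.map f).app _ ≫ U n c' = U n c ≫ (F.map f).app _)
    (hd : ∀ n c, U (n + 1) c ≫ alternatingD (F.obj c) n = alternatingD (F.obj c) n ≫ U n c)
    (n : ℕ) (c : C) :
    𝒟.homotopy U (n + 1) c ≫ alternatingD (F.obj c) (n + 1) = U (n + 1) c -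
      (F.obj c).δ 0 ≫ 𝒟.homotopy U n c -
      ((F.obj c).σ 0 ≫ 𝒟.shift (fun c => alternatingD (F.obj c) n) c) ≫ 𝒟.shift (U n) c +
      𝒟.shift (𝒟.homotopy U n) c ≫ 𝒟.shift (fun c => alternatingD (F.obj c) n) c := by
  have h1 : (F.obj c).σ 0 ≫ (F.obj c).δ 0 = 𝟙 _ :=
    (F.obj c).δ_comp_σ_self (i := (0 : Fin (n + 2)))
  rw [homotopy, 𝒟.alternatingD_succ, Preadditive.comp_sub, Preadditive.sub_comp,
    Preadditive.sub_comp, Category.assoc, 𝒟.shift_δ_zero _ (hU _), reassoc_of% h1,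
    𝒟.shift_δ_zero _ (𝒟.homotopy_naturality hU n), Category.assoc, Category.assoc,
    𝒟.shift_comp_shift, 𝒟.shift_comp_shift]
  simp only [hd]
  rw [← 𝒟.shift_comp_shift]
  abel

/-- Write `d = δ 0 - d'`, with a prime for `shift`. Above the lowest degree, both `σ 0 ≫ U'` and, by
induction, the shifted homotopy are null-homotopies of `U'` with respect to `d'`, so their
difference contributes nothing through `d'`. Through `δ 0` the first gives `U`, and the second
cancels against `δ 0 ≫ homotopy`. -/
lemma homotopy_comm (hU : ∀ (n : ℕ) {c c' : C} (f : c ⟶ c'),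
      (F.map f).app _ ≫ U n c' = U n c ≫ (F.map f).app _)
    (hd : ∀ n c, U (n + 1) c ≫ alternatingD (F.obj c) n = alternatingD (F.obj c) n ≫ U n c)
    (h0 : ∀ c, U 0 c = 0) (n : ℕ) (c : C) :
    𝒟.homotopy U (n + 1) c ≫ alternatingD (F.obj c) (n + 1) +
      alternatingD (F.obj c) n ≫ 𝒟.homotopy U n c = U (n + 1) c := by
  induction n generalizing c with
  | zero =>
    -- `σ_shift_alternatingD` does not reach this degree; the term containing `σ 0` disappears
    -- because `U 0 = 0`.
    have hU0 : U 0 = fun _ => 0 := funext h0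
    have hS0 : 𝒟.homotopy U 0 = fun _ => 0 := rfl
    rw [𝒟.homotopy_comp_alternatingD hU hd, hU0, hS0, 𝒟.shift_zero, 𝒟.shift_zero]
    simp
  | succ n ih =>
    have ih' : 𝒟.shift (𝒟.homotopy U (n + 1)) c ≫
        𝒟.shift (fun c => alternatingD (F.obj c) (n + 1)) c +
        𝒟.shift (fun c => alternatingD (F.obj c) n) c ≫ 𝒟.shift (𝒟.homotopy U n) c =
        𝒟.shift (U (n + 1)) c := by
      rw [𝒟.shift_comp_shift, 𝒟.shift_comp_shift, ← 𝒟.shift_add]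
      congr 1
      funext c
      exact ih c
    have hS : 𝒟.homotopy U (n + 1) c = (F.obj c).σ 0 ≫ 𝒟.shift (U (n + 1)) c -
      𝒟.shift (𝒟.homotopy U n) c := rfl
    have e1 : 𝒟.shift (fun c => alternatingD (F.obj c) n) c ≫ 𝒟.homotopy U (n + 1) c =
        𝒟.shift (fun c => alternatingD (F.obj c) n) c ≫ (F.obj c).σ 0 ≫ 𝒟.shift (U (n + 1)) c -
        𝒟.shift (fun c => alternatingD (F.obj c) n) c ≫ 𝒟.shift (𝒟.homotopy U n) c := by
      rw [hS, Preadditive.comp_sub]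
    rw [𝒟.homotopy_comp_alternatingD hU hd, 𝒟.σ_shift_alternatingD, Preadditive.sub_comp,
      Category.id_comp, 𝒟.alternatingD_succ n c, Preadditive.sub_comp, e1, Category.assoc]
    conv_lhs =>
      enter [1, 1, 2, 1]
      rw [← ih']
    abel

end Decalage

end

/-! ### Décalage of tensor products and the homotopy on `N(A ⊗ B)`. -/

section

/-- Adjoining a new initial vertex to a simplex. -/
def coneFunctor : SimplexCategory ⥤ SimplexCategory where
  obj Δ := ⦋Δ.len + 1⦌
  map {Δ Δ'} θ := SimplexCategory.mkHom
    { toFun := Fin.cases 0 fun i => (θ.toOrderHom i).succ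
      monotone' := fun i j h => by
        induction i using Fin.cases with
        | zero => exact Fin.zero_le _
        | succ i =>
          induction j using Fin.cases with
          | zero => exact absurd h (by simp)
          | succ j =>
            exact Fin.succ_le_succ_iff.2
              (θ.toOrderHom.monotone (Fin.succ_le_succ_iff.1 h)) }
  map_id Δ := by
    ext i
    induction i using Fin.cases <;> rfl
  map_comp θ η := by
    ext i
    induction i using Fin.cases <;> rfl

/-- The inclusion of a simplex in its cone. -/
def coneIncl : 𝟭 SimplexCategory ⟶ coneFunctor where
  app Δ := SimplexCategory.δ (n := Δ.len) 0
  naturality Δ Δ' θ := by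
    ext i
    rfl

lemma coneFunctor_map_δ {n : ℕ} (i : Fin (n + 2)) :
    coneFunctor.map (SimplexCategory.δ i) = SimplexCategory.δ i.succ := by
  ext j
  induction j using Fin.cases with
  | zero => rfl
  | succ j => exact congrArg Fin.val (Fin.succ_succAbove_succ i j).symm

/-- The décalage of a simplicial module. -/
def decalage : SimplicialObject (ModuleCat.{u} R) ⥤ SimplicialObject (ModuleCat.{u} R) :=
  (Functor.whiskeringLeft _ _ _).obj coneFunctor.op

/-- The map `d_0` from the décalage. -/
def decalageProj : decalage (R := R) ⟶ 𝟭 _ :=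
  (Functor.whiskeringLeft _ _ (ModuleCat.{u} R)).map (NatTrans.op coneIncl)

/-- The décalage of a tensor product of two simplicial modules. -/
def tensorDecalage : Decalage (MonoidalCategory.tensor (SimplicialObject (ModuleCat.{u} R))) where
  D := decalage.prod decalage
  p := { app := fun c => ((decalageProj.app c.1, decalageProj.app c.2) : _ × _)
         naturality := fun c c' f => Prod.ext (decalageProj.naturality f.1)
             (decalageProj.naturality f.2) }
  -- The tensor product is degreewise, so shifting both factors gives `A_{n+1} ⊗ B_{n+1}` on the
  -- nose.
  e c n := Iso.refl _
  e_naturality f n := rfl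
  p_app c n := rfl
  δ_e c n i := by
    change (c.1.map (coneFunctor.map (SimplexCategory.δ i)).op ⊗ₘ
      c.2.map (coneFunctor.map (SimplexCategory.δ i)).op) ≫ 𝟙 _ = 𝟙 _ ≫ (c.1 ⊗ c.2).map _
    rw [coneFunctor_map_δ, Category.comp_id, Category.id_comp]
    rfl

/-- The composite of the Alexander--Whitney and Eilenberg--Zilber maps. -/
def awEZ (A B : SimplicialObject (ModuleCat.{u} R)) :
    (normalization R).obj (A ⊗ B) ⟶ (normalization R).obj (A ⊗ B) :=
  awComp (EZn A B) (isPairing_EZn A B)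

lemma awEZ_naturality {A B A' B' : SimplicialObject (ModuleCat.{u} R)} (f : A ⟶ A') (g : B ⟶ B') :
    (normalization R).map (f ⊗ₘ g) ≫ awEZ A' B' = awEZ A B ≫ (normalization R).map (f ⊗ₘ g) := by
  rw [awEZ, awEZ, awComp_comp]
  exact map_awComp f g _ _ _ _ fun p q n => EZn_normMap f g p q n

lemma subsingleton_hom_zero (f g : (⦋0⦌ : SimplexCategory) ⟶ ⦋0⦌) : f = g :=
  simplexHom_ext fun x => by
    have h1 : (f.toOrderHom x : ℕ) < 0 + 1 := (f.toOrderHom x).2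
    have h2 : (g.toOrderHom x : ℕ) < 0 + 1 := (g.toOrderHom x).2
    omega

/-- In degree 0 there is only the empty shuffle, and front and back faces are trivial. This provides
the vanishing in degree 0 that the recursion needs. -/
lemma awEZ_f_zero (A B : SimplicialObject (ModuleCat.{u} R)) : (awEZ A B).f 0 = 𝟙 _ := by
  have hP : normProj A 0 ≫ normIncl A 0 = 𝟙 _ := normProj_normIncl_zero A
  have hP' : normProj B 0 ≫ normIncl B 0 = 𝟙 _ := normProj_normIncl_zero B
  have hc : (∅ : Finset (Fin 0))ᶜ.card = 0 := rfl
  have hs : shuffleN A B 0 0 0 = 𝟙 (A.obj (op ⦋0⦌) ⊗ B.obj (op ⦋0⦌)) := by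
    rw [shuffleN, Finset.sum_eq_single ∅ (fun μ _ hμ => (hμ (Subsingleton.elim _ _)).elim)
      (fun h => (h (Finset.mem_univ _)).elim), shuffleTerm_of_card A B ∅ Finset.card_empty hc,
          tensorMap,
      subsingleton_hom_zero (stepMap _ _) (𝟙 _), subsingleton_hom_zero (stepMap _ _) (𝟙 _),
      op_id, A.map_id, B.map_id, show inversions (∅ : Finset (Fin 0)) = 0 from rfl, pow_zero]
    exact (one_smul R _).trans (id_tensorHom_id _ _)
  have hf : frontBack A B 0 0 0 rfl = 𝟙 _ := by
    rw [frontBack, subsingleton_hom_zero (SimplexCategory.subinterval _ _ _) (𝟙 _), op_id, A.map_id,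
      B.map_id]
    exact id_tensorHom_id _ _
  rw [awEZ, awComp_f, Finset.Nat.antidiagonal_zero, Finset.sum_singleton,
    show AWn A B (0, 0).1 (0, 0).2 0 =
    AW A B 0 0 0 rfl from dif_pos rfl, AW_eq, hf, EZn, hs, normIncl₂]
  have h1 : (normProj A 0 ⊗ₘ normProj B 0) ≫ (normIncl A 0 ⊗ₘ normIncl B 0) = 𝟙 _ := by
    rw [tensorHom_comp_tensorHom, hP, hP', id_tensorHom_id]
  have h2 : (normProj A 0 ⊗ₘ normProj B 0) ≫ (normIncl A 0 ⊗ₘ normIncl B 0) ≫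
      normProj (A ⊗ B) 0 = normProj (A ⊗ B) 0 := by
    exact (Category.assoc _ _ _).symm.trans ((congrArg (· ≫ normProj (A ⊗ B) 0) h1).trans
      (Category.id_comp _))
  refine Eq.trans ?_ (normIncl_normProj (A ⊗ B) 0)
  refine (Category.assoc _ _ _).trans (congrArg (normIncl (A ⊗ B) 0 ≫ ·) ?_)
  refine (Category.assoc _ _ _).trans ((Category.id_comp _).trans ?_)
  refine Eq.trans ?_ h2
  refine congrArg ((normProj A 0 ⊗ₘ normProj B 0) ≫ ·)
    (congrArg ((normIncl A 0 ⊗ₘ normIncl B 0) ≫ ·) ?_)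
  exact Category.id_comp _

/-- The difference between the composite of the Alexander--Whitney and Eilenberg--Zilber maps and
the identity. -/
def awEZDefect (A B : SimplicialObject (ModuleCat.{u} R)) :
    (normalization R).obj (A ⊗ B) ⟶ (normalization R).obj (A ⊗ B) := awEZ A B - 𝟙 _

lemma awEZDefect_naturality {A B A' B' : SimplicialObject (ModuleCat.{u} R)} (f : A ⟶ A')
    (g : B ⟶ B') : (normalization R).map (f ⊗ₘ g) ≫ awEZDefect A' B' =
      awEZDefect A B ≫ (normalization R).map (f ⊗ₘ g) := by
  rw [awEZDefect, awEZDefect, Preadditive.comp_sub, Preadditive.sub_comp, awEZ_naturality,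
    Category.comp_id, Category.id_comp]

/-- The extension of `awEZDefect` to the alternating face map complex. -/
def defectOperator (n : ℕ)
    (c : SimplicialObject (ModuleCat.{u} R) × SimplicialObject (ModuleCat.{u} R)) :
    (c.1 ⊗ c.2).obj (op ⦋n⦌) ⟶ (c.1 ⊗ c.2).obj (op ⦋n⦌) :=
  -- The recursion involves `σ 0`, which does not preserve normalized chains, so the defect is
  -- extended by zero on the kernel of `normProj`.
  normProj (c.1 ⊗ c.2) n ≫ (awEZDefect c.1 c.2).f n ≫ normIncl (c.1 ⊗ c.2) n

lemma defectOperator_naturality (n : ℕ)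
    {c c' : SimplicialObject (ModuleCat.{u} R) × SimplicialObject (ModuleCat.{u} R)} (f : c ⟶ c') :
    (f.1 ⊗ₘ f.2).app (op ⦋n⦌) ≫ defectOperator n c' =
      defectOperator n c ≫ (f.1 ⊗ₘ f.2).app (op ⦋n⦌) := by
  have h := HomologicalComplex.congr_hom (awEZDefect_naturality f.1 f.2) n
  rw [HomologicalComplex.comp_f, HomologicalComplex.comp_f] at h
  rw [defectOperator, defectOperator, ← Category.assoc, app_normProj, Category.assoc,
    Category.assoc, Category.assoc, ← normMap_normIncl, reassoc_of% h]

lemma defectOperator_alternatingD (n : ℕ)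
    (c : SimplicialObject (ModuleCat.{u} R) × SimplicialObject (ModuleCat.{u} R)) :
    defectOperator (n + 1) c ≫ alternatingD (c.1 ⊗ c.2) n =
      alternatingD (c.1 ⊗ c.2) n ≫ defectOperator n c := by
  rw [defectOperator, defectOperator, Category.assoc, Category.assoc, normIncl_alternatingD,
    reassoc_of% @alternatingD_normProj, HomologicalComplex.Hom.comm_assoc]

lemma defectOperator_zero
    (c : SimplicialObject (ModuleCat.{u} R) × SimplicialObject (ModuleCat.{u} R)) :
    defectOperator 0 c = 0 := by
  have h : (awEZDefect c.1 c.2).f 0 = 0 :=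
    (congrArg (· - 𝟙 _) (awEZ_f_zero c.1 c.2)).trans (sub_self _)
  rw [defectOperator, h, Limits.zero_comp, Limits.comp_zero]

/-- The Shih homotopy on the alternating face map complex. -/
def shihOperator (A B : SimplicialObject (ModuleCat.{u} R)) (n : ℕ) :
    (A ⊗ B).obj (op ⦋n⦌) ⟶ (A ⊗ B).obj (op ⦋n + 1⦌) :=
  tensorDecalage.homotopy defectOperator n (A, B)

lemma shihOperator_naturality {A B A' B' : SimplicialObject (ModuleCat.{u} R)} (f : A ⟶ A')
    (g : B ⟶ B') (n : ℕ) : (f ⊗ₘ g).app (op ⦋n⦌) ≫ shihOperator A' B' n =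
      shihOperator A B n ≫ (f ⊗ₘ g).app (op ⦋n + 1⦌) :=
  tensorDecalage.homotopy_naturality (fun n _ _ f => defectOperator_naturality n f) n
    (show (A, B) ⟶ (A', B') from (f, g))

lemma shihOperator_comm (A B : SimplicialObject (ModuleCat.{u} R)) (n : ℕ) :
    shihOperator A B (n + 1) ≫ alternatingD (A ⊗ B) (n + 1) +
      alternatingD (A ⊗ B) n ≫ shihOperator A B n = defectOperator (n + 1) (A, B) :=
  tensorDecalage.homotopy_comm (fun n _ _ f => defectOperator_naturality n f)
    (fun n c => defectOperator_alternatingD n c) (fun c => defectOperator_zero c) n (A, B)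

/-- The Eilenberg--Mac Lane--Shih homotopy: a natural homotopy from the composite of the
Alexander--Whitney and Eilenberg--Zilber maps to the identity of `N(A ⊗ B)`. -/
def shih (A B : SimplicialObject (ModuleCat.{u} R)) (n : ℕ) :
    ((normalization R).obj (A ⊗ B)).X n ⟶ ((normalization R).obj (A ⊗ B)).X (n + 1) :=
  normIncl (A ⊗ B) n ≫ shihOperator A B n ≫ normProj (A ⊗ B) (n + 1)

lemma shih_naturality {A B A' B' : SimplicialObject (ModuleCat.{u} R)} (f : A ⟶ A') (g : B ⟶ B')
    (n : ℕ) : ((normalization R).map (f ⊗ₘ g)).f n ≫ shih A' B' n =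
      shih A B n ≫ ((normalization R).map (f ⊗ₘ g)).f (n + 1) := by
  have h := shihOperator_naturality f g n
  rw [shih, shih, reassoc_of% @normMap_normIncl, reassoc_of% h, Category.assoc, Category.assoc,
    app_normProj]

lemma shih_zero (A B : SimplicialObject (ModuleCat.{u} R)) : shih A B 0 = 0 := by
  have h : shihOperator A B 0 = 0 := rfl
  rw [shih, h, Limits.zero_comp, Limits.comp_zero]

lemma shih_comm (A B : SimplicialObject (ModuleCat.{u} R)) (n : ℕ) :
    shih A B (n + 1) ≫ ((normalization R).obj (A ⊗ B)).d (n + 2) (n + 1) +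
      ((normalization R).obj (A ⊗ B)).d (n + 1) n ≫ shih A B n = (awEZDefect A B).f (n + 1) := by
  rw [shih, shih, Category.assoc, Category.assoc, ← alternatingD_normProj,
    ← reassoc_of% @normIncl_alternatingD, ← Preadditive.comp_add,
    ← Category.assoc (shihOperator A B _),
    ← Category.assoc (alternatingD _ _), ← Preadditive.add_comp, shihOperator_comm,
    defectOperator, Category.assoc, Category.assoc, normIncl_normProj, Category.comp_id,
    ← Category.assoc, normIncl_normProj, Category.id_comp]

end

section

/-! ### The tensor-hom adjunction of simplicial modules -/

variable {A B K A' B' K' : SimplicialObject (ModuleCat.{u} R)}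

/-- The value of a map `A ⊗ K ⟶ B` at a pair of simplices. -/
def pairing (f : A ⊗ K ⟶ B) (m : SimplexCategoryᵒᵖ) (a : A.obj m) (k : K.obj m) : B.obj m :=
  (f.app m).hom (a ⊗ₜ[R] k)

lemma pairing_ext {f g : A ⊗ K ⟶ B} (h : ∀ m a k, pairing f m a k = pairing g m a k) : f = g :=
  NatTrans.ext (funext fun m => ModuleCat.hom_ext (TensorProduct.ext' fun a k => h m a k))

lemma pairing_add_right (f : A ⊗ K ⟶ B) (m : SimplexCategoryᵒᵖ) (a : A.obj m) (k l : K.obj m) :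
    pairing f m a (k + l) = pairing f m a k + pairing f m a l := by
  rw [pairing, TensorProduct.tmul_add]
  exact map_add (f.app m).hom _ _

lemma pairing_smul_right (f : A ⊗ K ⟶ B) (m : SimplexCategoryᵒᵖ) (a : A.obj m) (r : R)
    (k : K.obj m) : pairing f m a (r • k) = r • pairing f m a k := by
  rw [pairing, TensorProduct.tmul_smul]
  exact map_smul (f.app m).hom _ _

lemma pairing_map (f : A ⊗ K ⟶ B) {m m' : SimplexCategoryᵒᵖ} (θ : m ⟶ m') (a : A.obj m)
    (k : K.obj m) : pairing f m' ((A.map θ).hom a) ((K.map θ).hom k) =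
      (B.map θ).hom (pairing f m a k) :=
  congrArg (fun g => g.hom (a ⊗ₜ[R] k)) (f.naturality θ)

lemma pairing_whiskerLeft_comp (κ : K' ⟶ K) (f : A ⊗ K ⟶ B) (m : SimplexCategoryᵒᵖ) (a : A.obj m)
    (k : K'.obj m) : pairing ((A ◁ κ) ≫ f) m a k = pairing f m a ((κ.app m).hom k) := rfl

/-- The basis element of `(RΔⁿ)_m` given by a map `[m] ⟶ [n]`. -/
def simplexMk {m n : SimplexCategory} (θ : m ⟶ n) : ((freeSimplex R).obj n).obj (op m) :=
  ModuleCat.freeMk (SSet.stdSimplex.objEquiv (m := op m) |>.symm θ)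

lemma freeSimplex_map_simplexMk {m n n' : SimplexCategory} (θ : m ⟶ n) (η : n ⟶ n') :
    (((freeSimplex R).map η).app (op m)).hom (simplexMk θ) = simplexMk (θ ≫ η) :=
  ModuleCat.free_map_apply (R := R) ((SSet.stdSimplex.map η).app (op m)) _

lemma map_simplexMk {m m' n : SimplexCategory} (θ : m ⟶ n) (η : m' ⟶ m) :
    (((freeSimplex R).obj n).map η.op).hom (simplexMk θ) = simplexMk (η ≫ θ) :=
  ModuleCat.free_map_apply (R := R) ((SSet.stdSimplex.obj n).map η.op) _

lemma freeSimplex_hom_ext {n : SimplexCategory} {f g : A ⊗ (freeSimplex R).obj n ⟶ B}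
    (h : ∀ (m : SimplexCategory) (a : A.obj (op m)) (θ : m ⟶ n),
      pairing f (op m) a (simplexMk θ) = pairing g (op m) a (simplexMk θ)) : f = g := by
  refine pairing_ext fun m a k => ?_
  have key : ModuleCat.ofHom (X := (ModuleCat.free R).obj ((SSet.stdSimplex.obj n).obj m))
      ((f.app m).hom ∘ₗ TensorProduct.mk R (A.obj m) (((freeSimplex R).obj n).obj m) a) =
      ModuleCat.ofHom ((g.app m).hom ∘ₗ TensorProduct.mk R _ (((freeSimplex R).obj n).obj m) a) :=
    ModuleCat.free_hom_ext fun x => h m.unop a (SSet.stdSimplex.objEquiv x)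
  exact congrArg (fun φ => φ.hom k) key

/-- The map `RΔⁿ ⟶ K` classifying an `n`-simplex. -/
def simplexDesc {n : SimplexCategory} (k : K.obj (op n)) : (freeSimplex R).obj n ⟶ K where
  app m := ModuleCat.freeDesc (↾fun θ => (K.map (SSet.stdSimplex.objEquiv θ).op).hom k)
  naturality m m' θ := by
    refine ModuleCat.free_hom_ext fun x => ?_
    have h1 : (ModuleCat.freeDesc (↾fun θ => (K.map (SSet.stdSimplex.objEquiv θ).op).hom k)).hom
        (((ModuleCat.free R).map ((SSet.stdSimplex.obj n).map θ)).hom (ModuleCat.freeMk x)) =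
        (K.map (SSet.stdSimplex.objEquiv ((SSet.stdSimplex.obj n).map θ x)).op).hom k :=
      (congrArg _ (ModuleCat.free_map_apply (R := R) _ x)).trans (ModuleCat.freeDesc_apply _ _)
    have h2 : (ModuleCat.freeDesc (↾fun θ => (K.map (SSet.stdSimplex.objEquiv θ).op).hom k)).hom
        (ModuleCat.freeMk x) = (K.map (SSet.stdSimplex.objEquiv x).op).hom k :=
      ModuleCat.freeDesc_apply _ _
    refine h1.trans (Eq.trans ?_ (congrArg (K.map θ).hom h2).symm)
    exact congrArg (fun g => g.hom k) (K.map_comp (SSet.stdSimplex.objEquiv x).op θ)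

lemma simplexDesc_simplexMk {m n : SimplexCategory} (k : K.obj (op n)) (θ : m ⟶ n) :
    ((simplexDesc k).app (op m)).hom (simplexMk θ) = (K.map θ.op).hom k :=
  ModuleCat.freeDesc_apply _ _

lemma pairing_simplexDesc (f : A ⊗ K ⟶ B) {m n : SimplexCategory} (k : K.obj (op n))
    (a : A.obj (op m)) (θ : m ⟶ n) :
    pairing ((A ◁ simplexDesc k) ≫ f) (op m) a (simplexMk θ) =
      pairing f (op m) a ((K.map θ.op).hom k) := by
  rw [pairing_whiskerLeft_comp, simplexDesc_simplexMk]

/-- The map `K ⟶ B^A` corresponding to a map `A ⊗ K ⟶ B`. -/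
def curry (f : A ⊗ K ⟶ B) : K ⟶ simplicialHom.obj (op A, B) where
  app n := ModuleCat.ofHom
    { toFun := fun k => (A ◁ simplexDesc (n := n.unop) k) ≫ f
      map_add' := fun k l => freeSimplex_hom_ext fun m a θ => by
        refine Eq.trans ?_ (congrArg₂ (· + ·) (pairing_simplexDesc f (n := n.unop) k a θ)
          (pairing_simplexDesc f (n := n.unop) l a θ)).symm
        rw [pairing_simplexDesc, map_add, pairing_add_right]
      map_smul' := fun r k => freeSimplex_hom_ext fun m a θ => by
        refine Eq.trans ?_ (congrArg (r • ·) (pairing_simplexDesc f (n := n.unop) k a θ)).symm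
        rw [pairing_simplexDesc, map_smul, pairing_smul_right] }
  naturality n n' θ := by
    refine ModuleCat.hom_ext (LinearMap.ext fun k => freeSimplex_hom_ext fun m a η => ?_)
    change pairing ((A ◁ simplexDesc (n := n'.unop) ((K.map θ).hom k)) ≫ f) (op m) a (simplexMk η) =
      pairing ((A ◁ (freeSimplex R).map θ.unop) ≫ (A ◁ simplexDesc (n := n.unop) k) ≫ f) (op m) a
        (simplexMk η)
    rw [pairing_simplexDesc, pairing_whiskerLeft_comp ((freeSimplex R).map θ.unop),
      freeSimplex_map_simplexMk, pairing_simplexDesc]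
    exact congrArg (fun g => pairing f (op m) a (g.hom k)) (K.map_comp θ η.op).symm

/-- An `n`-simplex of `B^A`, as a map `A ⊗ RΔⁿ ⟶ B`. -/
def toHom {n : SimplexCategory} (f : (simplicialHom.obj (op A, B)).obj (op n)) :
    A ⊗ (freeSimplex R).obj n ⟶ B := f

lemma toHom_injective {n : SimplexCategory} {f g : (simplicialHom.obj (op A, B)).obj (op n)}
    (h : ∀ (m : SimplexCategory) (a : A.obj (op m)) (θ : m ⟶ n),
      pairing (toHom f) (op m) a (simplexMk θ) = pairing (toHom g) (op m) a (simplexMk θ)) :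
    f = g := freeSimplex_hom_ext h

lemma pairing_curry (f : A ⊗ K ⟶ B) {m n : SimplexCategory} (k : K.obj (op n)) (a : A.obj (op m))
    (θ : m ⟶ n) : pairing (toHom (((curry f).app (op n)).hom k)) (op m) a (simplexMk θ) =
      pairing f (op m) a ((K.map θ.op).hom k) := pairing_simplexDesc f k a θ

lemma pairing_eval (m : SimplexCategory) (a : A.obj (op m))
    (f : (simplicialHom.obj (op A, B)).obj (op m)) :
    pairing (simplicialEval A B) (op m) a f = pairing (toHom f) (op m) a (simplexMk (𝟙 m)) := rfl

lemma pairing_toHom_map {m n n' : SimplexCategory} (η : n ⟶ n') (a : A.obj (op m))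
    (f : (simplicialHom.obj (op A, B)).obj (op n')) (θ : m ⟶ n) :
    pairing (toHom (((simplicialHom.obj (op A, B)).map η.op).hom f)) (op m) a (simplexMk θ) =
      pairing (toHom f) (op m) a (simplexMk (θ ≫ η)) := by
  rw [← freeSimplex_map_simplexMk θ η]
  rfl

lemma pairing_simplicialTranspose (ψ : K ⟶ simplicialHom.obj (op A, B)) (m : SimplexCategory)
    (a : A.obj (op m)) (k : K.obj (op m)) : pairing (simplicialTranspose ψ) (op m) a k =
      pairing (toHom ((ψ.app (op m)).hom k)) (op m) a (simplexMk (𝟙 m)) := rfl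

/-- By naturality of `ψ`, the value at any `θ` is the value at the fundamental simplex after
restricting `k` along `θ`. Hence a map into `B^A` is determined by its transpose. -/
lemma pairing_toHom_app (ψ : K ⟶ simplicialHom.obj (op A, B)) {m n : SimplexCategory}
    (k : K.obj (op n)) (a : A.obj (op m)) (θ : m ⟶ n) :
    pairing (toHom ((ψ.app (op n)).hom k)) (op m) a (simplexMk θ) =
      pairing (simplicialTranspose ψ) (op m) a ((K.map θ.op).hom k) := by
  have h : (ψ.app (op m)).hom ((K.map θ.op).hom k) =
      ((simplicialHom.obj (op A, B)).map θ.op).hom ((ψ.app (op n)).hom k) :=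
    congrArg (fun g => g.hom k) (ψ.naturality θ.op)
  rw [pairing_simplicialTranspose, h, pairing_toHom_map, Category.id_comp]

lemma simplicialTranspose_curry (f : A ⊗ K ⟶ B) : simplicialTranspose (curry f) = f :=
  pairing_ext fun m a k => by
    refine (pairing_simplicialTranspose (curry f) m.unop a k).trans
      ((pairing_curry f (n := m.unop) k a (𝟙 _)).trans ?_)
    rw [op_id, K.map_id]
    rfl

lemma simplicialTranspose_injective {ψ ψ' : K ⟶ simplicialHom.obj (op A, B)}
    (h : simplicialTranspose ψ = simplicialTranspose ψ') : ψ = ψ' :=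
  NatTrans.ext (funext fun n => ModuleCat.hom_ext (LinearMap.ext fun k =>
    toHom_injective (n := n.unop) fun m a θ => by
      refine (pairing_toHom_app ψ (n := n.unop) k a θ).trans ?_
      rw [h]
      exact (pairing_toHom_app ψ' (n := n.unop) k a θ).symm))

lemma simplicialTranspose_precomp (κ : K' ⟶ K) (ψ : K ⟶ simplicialHom.obj (op A, B)) :
    simplicialTranspose (κ ≫ ψ) = (A ◁ κ) ≫ simplicialTranspose ψ := by
  rw [simplicialTranspose, simplicialTranspose, MonoidalCategory.whiskerLeft_comp, Category.assoc]

/-- The functoriality of `B^A`. -/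
def simplicialHomMap (α : A' ⟶ A) (β : B ⟶ B') :
    simplicialHom.obj (op A, B) ⟶ simplicialHom.obj (op A', B') :=
  simplicialHom.map ((α.op, β) :
    ((op A, B) : (SimplicialObject (ModuleCat.{u} R))ᵒᵖ × _) ⟶ (op A', B'))

lemma pairing_simplicialHomMap (α : A' ⟶ A) (β : B ⟶ B') {m n : SimplexCategory}
    (f : (simplicialHom.obj (op A, B)).obj (op n)) (a : A'.obj (op m)) (θ : m ⟶ n) :
    pairing (toHom (((simplicialHomMap α β).app (op n)).hom f)) (op m) a (simplexMk θ) =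
      (β.app (op m)).hom (pairing (toHom f) (op m) ((α.app (op m)).hom a) (simplexMk θ)) := rfl

lemma simplicialTranspose_map (ψ : K ⟶ simplicialHom.obj (op A, B)) (α : A' ⟶ A) (β : B ⟶ B') :
    simplicialTranspose (ψ ≫ simplicialHomMap α β) = (α ▷ K) ≫ simplicialTranspose ψ ≫ β :=
  pairing_ext fun _ _ _ => rfl

lemma curry_precomp (κ : K' ⟶ K) (f : A ⊗ K ⟶ B) : κ ≫ curry f = curry ((A ◁ κ) ≫ f) :=
  simplicialTranspose_injective (by
    rw [simplicialTranspose_precomp, simplicialTranspose_curry, simplicialTranspose_curry])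

lemma curry_map (f : A ⊗ K ⟶ B) (α : A' ⟶ A) (β : B ⟶ B') :
    curry f ≫ simplicialHomMap α β = curry ((α ▷ K) ≫ f ≫ β) :=
  simplicialTranspose_injective (by
    rw [simplicialTranspose_map, simplicialTranspose_curry, simplicialTranspose_curry])

lemma curry_eval : curry (simplicialEval A B) = 𝟙 _ :=
  simplicialTranspose_injective (by
    rw [simplicialTranspose_curry, simplicialTranspose, MonoidalCategory.whiskerLeft_id,
      Category.id_comp])

/-- The currying map `B^{A ⊗ K} ⟶ (B^A)^K`. -/
def curryHom (A K B : SimplicialObject (ModuleCat.{u} R)) : simplicialHom.obj (op (A ⊗ K), B) ⟶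
    simplicialHom.obj (op K, simplicialHom.obj (op A, B)) :=
  curry (curry ((α_ _ _ _).inv ≫ simplicialEval (A ⊗ K) B))

lemma pairing_curryHom {l m n : SimplexCategory}
    (f : (simplicialHom.obj (op (A ⊗ K), B)).obj (op n))
    (k : K.obj (op m)) (a : A.obj (op l)) (θ : m ⟶ n) (η : l ⟶ m) :
    pairing (toHom (pairing (toHom (((curryHom A K B).app (op n)).hom f)) (op m) k (simplexMk θ)))
      (op l) a (simplexMk η) =
    pairing (toHom f) (op l) (a ⊗ₜ[R] (K.map η.op).hom k) (simplexMk (η ≫ θ)) := by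
  have h : pairing (toHom (((curryHom A K B).app (op n)).hom f)) (op m) k (simplexMk θ) =
      ((curry ((α_ A K _).inv ≫ simplicialEval (A ⊗ K) B)).app (op m)).hom
        (k ⊗ₜ[R] ((simplicialHom.obj (op (A ⊗ K), B)).map θ.op).hom f) := pairing_curry _ _ _ _
  rw [h]
  refine (pairing_curry _ _ _ _).trans ?_
  change pairing (toHom (((simplicialHom.obj (op (A ⊗ K), B)).map η.op).hom
      (((simplicialHom.obj (op (A ⊗ K), B)).map θ.op).hom f))) (op l)
      (a ⊗ₜ[R] (K.map η.op).hom k) (simplexMk (𝟙 l)) = _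
  refine (pairing_toHom_map _ _ _ _).trans ((pairing_toHom_map _ _ _ _).trans ?_)
  rw [Category.id_comp]

lemma curryHom_naturality (α : A' ⟶ A) (κ : K' ⟶ K) (β : B ⟶ B') :
    simplicialHomMap (α ⊗ₘ κ) β ≫ curryHom A' K' B' =
      curryHom A K B ≫ simplicialHomMap κ (simplicialHomMap α β) := by
  refine NatTrans.ext (funext fun n => ModuleCat.hom_ext (LinearMap.ext fun f =>
    toHom_injective (n := n.unop) fun m k θ => toHom_injective fun l a η => ?_))
  refine (pairing_curryHom _ k a θ η).trans ?_
  refine Eq.trans ?_ (congrArg (β.app (op l)).hom (pairing_curryHom f ((κ.app (op m)).hom k)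
    ((α.app (op l)).hom a) θ η)).symm
  have h : (κ.app (op l)).hom ((K'.map η.op).hom k) = (K.map η.op).hom ((κ.app (op m)).hom k) :=
    congrArg (fun g => g.hom k) (κ.naturality η.op)
  rw [← h]
  exact pairing_simplicialHomMap (α ⊗ₘ κ) β f _ _

/-- The vertex of `B^A` given by a map `A ⟶ B`. -/
def vertex (α : A ⟶ B) : (simplicialHom.obj (op A, B)).obj (op ⦋0⦌) :=
  ((curry ((ρ_ A).hom ≫ α)).app (op ⦋0⦌)).hom (1 : R)

lemma pairing_vertex (α : A ⟶ B) {m : SimplexCategory} (a : A.obj (op m)) (θ : m ⟶ ⦋0⦌) :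
    pairing (toHom (vertex α)) (op m) a (simplexMk θ) = (α.app (op m)).hom a := by
  refine (pairing_curry (K := 𝟙_ _) ((ρ_ A).hom ≫ α) (n := ⦋0⦌) (1 : R) a θ).trans ?_
  exact congrArg (α.app (op m)).hom (one_smul R a)

/-- `⦋0⦌` is terminal, so `RΔ⁰` is free on one generator in each degree, and a map `A ⊗ RΔ⁰ ⟶ B` is
determined by its values at that generator. -/
lemma vertex_surjective (f : (simplicialHom.obj (op A, B)).obj (op ⦋0⦌)) :
    ∃ α : A ⟶ B, vertex α = f := by
  have h (m : SimplexCategory) (θ θ' : m ⟶ ⦋0⦌) : θ = θ' :=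
    simplexHom_ext fun x => by
      have h1 : (θ.toOrderHom x : ℕ) < 0 + 1 := (θ.toOrderHom x).2
      have h2 : (θ'.toOrderHom x : ℕ) < 0 + 1 := (θ'.toOrderHom x).2
      omega
  refine ⟨{ app := fun m => ModuleCat.ofHom (((toHom f).app m).hom ∘ₗ (TensorProduct.mk R (A.obj m)
              (((freeSimplex R).obj ⦋0⦌).obj m)).flip
                (simplexMk (SimplexCategory.const m.unop ⦋0⦌ 0)))
            naturality := fun m m' θ => ModuleCat.hom_ext (LinearMap.ext fun a => ?_) },
    toHom_injective fun m a θ => ?_⟩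
  · refine Eq.trans ?_ (pairing_map (toHom f) θ a
      (simplexMk (SimplexCategory.const m.unop ⦋0⦌ 0)))
    refine congrArg (pairing (toHom f) m' ((A.map θ).hom a)) ?_
    refine Eq.trans ?_ (map_simplexMk _ θ.unop).symm
    rw [h _ (θ.unop ≫ _)]
  · rw [pairing_vertex, h m θ (SimplexCategory.const m ⦋0⦌ 0)]
    rfl

lemma curryHom_vertex (f : A ⊗ K ⟶ B) :
    ((curryHom A K B).app (op ⦋0⦌)).hom (vertex f) = vertex (curry f) :=
  toHom_injective fun m k θ => toHom_injective fun l a η => by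
    refine (pairing_curryHom _ k a θ η).trans ((pairing_vertex f _ _).trans ?_)
    refine Eq.trans ?_ (congrArg (fun x => pairing (toHom x) (op l) a (simplexMk η))
      (pairing_vertex (curry f) k θ)).symm
    exact (pairing_curry f k a η).symm

end

section

/-! ### The duals of the Eilenberg--Zilber and Alexander--Whitney maps -/

variable {A B K A' B' K' : SimplicialObject (ModuleCat.{u} R)}

instance : (normalization R).IsEquivalence :=
  inferInstanceAs (Abelian.DoldKan.equivalence (A := ModuleCat.{u} R)).functor.IsEquivalence

/-- The complex `Hom(N A, N B)`. -/
abbrev normHomComplex (A B : SimplicialObject (ModuleCat.{u} R)) :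
    ChainComplex (ModuleCat.{u} R) ℕ :=
  homComplexFunctor.obj (op ((normalization R).obj A), (normalization R).obj B)

/-- The functoriality of `Hom(X, Y)`. -/
def homComplexMap {X Y X' Y' : ChainComplex (ModuleCat.{u} R) ℕ} (α : X' ⟶ X) (β : Y ⟶ Y') :
    homComplexFunctor.obj (op X, Y) ⟶ homComplexFunctor.obj (op X', Y') :=
  homComplexFunctor.map
    ((α.op, β) : ((op X, Y) : (ChainComplex (ModuleCat.{u} R) ℕ)ᵒᵖ × _) ⟶ (op X', Y'))

lemma chainTranspose_homComplexMap {X Y X' Y' K : ChainComplex (ModuleCat.{u} R) ℕ}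
    (φ : K ⟶ homComplexFunctor.obj (op X, Y)) (α : X' ⟶ X) (β : Y ⟶ Y')
    (p q n : ℕ) : chainTranspose (φ ≫ homComplexMap α β) p q n =
      (α.f p ▷ _) ≫ chainTranspose φ p q n ≫ β.f n := chainTranspose_map φ α β p q n

/-- The dual of the Eilenberg--Zilber map. -/
def ezDual (A B : SimplicialObject (ModuleCat.{u} R)) :
    (normalization R).obj (simplicialHom.obj (op A, B)) ⟶ normHomComplex A B :=
  ofPairing (fun p q n => EZn A (simplicialHom.obj (op A, B)) p q n ≫
    ((normalization R).map (simplicialEval A B)).f n) ((isPairing_EZn A _).comp _)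

lemma EZn_normMap_whiskerLeft (κ : K ⟶ K') (p q n : ℕ) :
    EZn A K p q n ≫ ((normalization R).map (A ◁ κ)).f n =
      (((normalization R).obj A).X p ◁ ((normalization R).map κ).f q) ≫ EZn A K' p q n := by
  have := EZn_normMap (𝟙 A) κ p q n
  rwa [CategoryTheory.Functor.map_id, HomologicalComplex.id_f, id_tensorHom, id_tensorHom] at this

lemma EZn_normMap_whiskerRight (α : A ⟶ A') (p q n : ℕ) :
    EZn A K p q n ≫ ((normalization R).map (α ▷ K)).f n =
      (((normalization R).map α).f p ▷ ((normalization R).obj K).X q) ≫ EZn A' K p q n := by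
  have := EZn_normMap α (𝟙 K) p q n
  rwa [CategoryTheory.Functor.map_id, HomologicalComplex.id_f, tensorHom_id, tensorHom_id] at this

lemma chainTranspose_ezDual (ψ : K ⟶ simplicialHom.obj (op A, B)) (p q n : ℕ) :
    chainTranspose ((normalization R).map ψ ≫ ezDual A B) p q n =
      EZn A K p q n ≫ ((normalization R).map (simplicialTranspose ψ)).f n := by
  rw [chainTranspose_precomp, ezDual, chainTranspose_ofPairing, simplicialTranspose,
    Functor.map_comp, HomologicalComplex.comp_f, reassoc_of% @EZn_normMap_whiskerLeft]

lemma ezDual_naturality (α : A' ⟶ A) (β : B ⟶ B') :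
    (normalization R).map (simplicialHomMap α β) ≫ ezDual A' B' =
      ezDual A B ≫ homComplexMap ((normalization R).map α) ((normalization R).map β) := by
  refine chainTranspose_injective fun p q n _ => ?_
  have h := chainTranspose_ezDual (𝟙 (simplicialHom.obj (op A, B))) p q n
  have h' := simplicialTranspose_map (𝟙 _) α β
  rw [Category.id_comp] at h'
  rw [CategoryTheory.Functor.map_id, Category.id_comp] at h
  rw [chainTranspose_ezDual, chainTranspose_homComplexMap, h, h', Functor.map_comp,
    Functor.map_comp, HomologicalComplex.comp_f, HomologicalComplex.comp_f,
    reassoc_of% @EZn_normMap_whiskerRight, Category.assoc]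

/-- The map `A ⊗ K ⟶ B` obtained by composing the transpose of `φ` with the Alexander--Whitney
map. -/
def awTranspose (φ : (normalization R).obj K ⟶ normHomComplex A B) : A ⊗ K ⟶ B :=
  (normalization R).preimage (awComp (chainTranspose φ) (isPairing_chainTranspose φ))

lemma map_awTranspose (φ : (normalization R).obj K ⟶ normHomComplex A B) :
    (normalization R).map (awTranspose φ) =
      awComp (chainTranspose φ) (isPairing_chainTranspose φ) :=
  (normalization R).map_preimage _

lemma awTranspose_precomp (κ : K' ⟶ K) (φ : (normalization R).obj K ⟶ normHomComplex A B) :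
    awTranspose ((normalization R).map κ ≫ φ) = (A ◁ κ) ≫ awTranspose φ := by
  refine (normalization R).map_injective ?_
  rw [map_awTranspose, Functor.map_comp, map_awTranspose, ← id_tensorHom]
  refine (map_awComp _ _ _ _ _ _ fun p q n => ?_).symm
  rw [chainTranspose_precomp, CategoryTheory.Functor.map_id, HomologicalComplex.id_f, id_tensorHom]

lemma awTranspose_map (φ : (normalization R).obj K ⟶ normHomComplex A B) (α : A' ⟶ A)
    (β : B ⟶ B') :
    awTranspose (φ ≫ homComplexMap ((normalization R).map α) ((normalization R).map β)) =
      (α ▷ K) ≫ awTranspose φ ≫ β := by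
  refine (normalization R).map_injective ?_
  rw [map_awTranspose, Functor.map_comp, Functor.map_comp, map_awTranspose, ← tensorHom_id,
    awComp_comp]
  refine (map_awComp _ _ _ _ _ _ fun p q n => ?_).symm
  rw [chainTranspose_homComplexMap, CategoryTheory.Functor.map_id, HomologicalComplex.id_f,
    tensorHom_id]

/-- The dual of the Alexander--Whitney map. -/
def awDual (A B : SimplicialObject (ModuleCat.{u} R)) :
    normHomComplex A B ⟶ (normalization R).obj (simplicialHom.obj (op A, B)) :=
  -- Dold–Kan supplies some `K` with `N K` isomorphic to the hom complex; `comp_awDual` shows that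
  -- the choice is immaterial.
  ((normalization R).objObjPreimageIso (normHomComplex A B)).inv ≫
    (normalization R).map
      (curry (awTranspose ((normalization R).objObjPreimageIso (normHomComplex A B)).hom))

/-- Since `N` is full, `φ` is `N κ` followed by the chosen isomorphism, and currying and
`awTranspose` are natural in `K`. This is the Yoneda description of `awDual` from which its other
properties follow. -/
lemma comp_awDual (φ : (normalization R).obj K ⟶ normHomComplex A B) :
    φ ≫ awDual A B = (normalization R).map (curry (awTranspose φ)) := by
  obtain ⟨κ, hκ⟩ := (normalization R).map_surjective
    (φ ≫ ((normalization R).objObjPreimageIso (normHomComplex A B)).inv)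
  have h : φ = (normalization R).map κ ≫
      ((normalization R).objObjPreimageIso (normHomComplex A B)).hom := by
    rw [hκ, Category.assoc, Iso.inv_hom_id, Category.comp_id]
  rw [awDual, ← Category.assoc, ← hκ, ← Functor.map_comp, curry_precomp, ← awTranspose_precomp, ← h]

lemma hom_ext_of_normalization {X Y : ChainComplex (ModuleCat.{u} R) ℕ} {f g : X ⟶ Y}
    (h : ∀ (K : SimplicialObject (ModuleCat.{u} R)) (φ : (normalization R).obj K ⟶ X),
      φ ≫ f = φ ≫ g) : f = g := by
  rw [← cancel_epi ((normalization R).objObjPreimageIso X).hom]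
  exact h _ _

lemma awDual_naturality (α : A' ⟶ A) (β : B ⟶ B') :
    homComplexMap ((normalization R).map α) ((normalization R).map β) ≫ awDual A' B' =
      awDual A B ≫ (normalization R).map (simplicialHomMap α β) :=
  hom_ext_of_normalization fun K φ => by
    rw [← Category.assoc, ← Category.assoc, comp_awDual, comp_awDual, awTranspose_map,
      ← Functor.map_comp, curry_map]

lemma awDual_ezDual (A B : SimplicialObject (ModuleCat.{u} R)) : awDual A B ≫ ezDual A B = 𝟙 _ :=
  hom_ext_of_normalization fun K φ => chainTranspose_injective fun p q n _ => by
    rw [← Category.assoc, comp_awDual, chainTranspose_ezDual, simplicialTranspose_curry,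
      map_awTranspose, EZn_awComp, Category.comp_id]

lemma ezDual_awDual (A B : SimplicialObject (ModuleCat.{u} R)) :
    ezDual A B ≫ awDual A B = (normalization R).map (curry (awTranspose (ezDual A B))) :=
  comp_awDual _

/-- The map whose curried form gives `ezDual ≫ awDual` is evaluation precomposed with `EZ ∘ AW`,
which is what `shih` compares with evaluation itself. -/
lemma map_awTranspose_ezDual (A B : SimplicialObject (ModuleCat.{u} R)) :
    (normalization R).map (awTranspose (ezDual A B)) =
      awEZ A _ ≫ (normalization R).map (simplicialEval A B) := by
  rw [map_awTranspose, awEZ, awComp_comp]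
  ext1 n
  rw [awComp_f, awComp_f]
  refine Finset.sum_congr rfl fun x _ => ?_
  rw [ezDual, chainTranspose_ofPairing]

end

section

/-! ### Chains of low degree in hom complexes -/

section lowDegree

variable {X Y X' Y' : ChainComplex (ModuleCat.{u} R) ℕ}

/-- The chain of degree zero given by a chain map. -/
def homToChain (α : X ⟶ Y) : homChains R X Y 0 :=
  ⟨fun p q => if h : p = q then α.f p ≫ eqToHom (congrArg Y.X h) else 0,
    fun p q h => dif_neg (by omega), fun _ p q => by
      beta_reduce
      by_cases h : p = q + 1
      · subst h
        simp
      · rw [dif_neg h, Limits.zero_comp]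
        obtain _ | p := p
        · rw [X.shape _ _ (by simp), Limits.zero_comp]
        · rw [dif_neg (by omega), Limits.comp_zero]⟩

lemma homToChain_self (α : X ⟶ Y) (p : ℕ) : (homToChain α).1 p p = α.f p := by
  simp [homToChain]

lemma homToChain_injective {α β : X ⟶ Y} (h : homToChain α = homToChain β) : α = β := by
  ext1 p
  rw [← homToChain_self, h, homToChain_self]

lemma homChains_ext {n : ℕ} {f g : homChains R X Y n} (h : ∀ p q, p + n = q → f.1 p q = g.1 p q) :
    f = g :=
  Subtype.ext (funext fun p => funext fun q => by
    by_cases hq : p + n = q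
    · exact h p q hq
    · rw [f.2.1 p q hq, g.2.1 p q hq])

/-- The chain of degree one given by a family of maps. -/
def chainOfHoms (s : ∀ p, X.X p ⟶ Y.X (p + 1)) : homChains R X Y 1 :=
  ⟨fun p q => if h : p + 1 = q then s p ≫ eqToHom (congrArg Y.X h) else 0,
    fun _ _ h => dif_neg h, fun h => absurd h one_ne_zero⟩

lemma chainOfHoms_self (s : ∀ p, X.X p ⟶ Y.X (p + 1)) (p : ℕ) :
    (chainOfHoms s).1 p (p + 1) = s p := by
  simp [chainOfHoms]

lemma d_chainOfHoms (s : ∀ p, X.X p ⟶ Y.X (p + 1)) (α β : X ⟶ Y)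
    (h₀ : s 0 ≫ Y.d 1 0 = α.f 0 - β.f 0)
    (h : ∀ p, s (p + 1) ≫ Y.d (p + 2) (p + 1) + X.d (p + 1) p ≫ s p =
      α.f (p + 1) - β.f (p + 1)) :
    ((homComplex X Y).d 1 0).hom (chainOfHoms s) = homToChain α - homToChain β := by
  refine homChains_ext fun p q hq => ?_
  obtain rfl : p = q := hq
  refine (congrFun (congrFun (homComplex_d_apply 0 (chainOfHoms s)) p) p).trans ?_
  change (chainOfHoms s).1 p (p + 1) ≫ Y.d (p + 1) p -
    (-1 : R) ^ 1 • (X.d p (p - 1) ≫ (chainOfHoms s).1 (p - 1) p) =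
      (homToChain α).1 p p - (homToChain β).1 p p
  rw [homToChain_self, homToChain_self, chainOfHoms_self, pow_one, neg_one_smul, sub_neg_eq_add]
  obtain _ | p := p
  · rw [X.shape _ _ (by simp), Limits.zero_comp, add_zero, h₀]
  · rw [Nat.add_sub_cancel, chainOfHoms_self, h]

lemma homComplexMap_apply (α : X' ⟶ X) (β : Y ⟶ Y') (n : ℕ) (f : homChains R X Y n) (p q : ℕ) :
    (((homComplexMap α β).f n).hom f : homChains R X' Y' n).1 p q =
      α.f p ≫ f.1 p q ≫ β.f q := rfl

/-- A chain of degree one whose boundary is the difference of two chain maps is a chain homotopy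
between them. -/
def homotopyOfChain (f g : X ⟶ Y) (s : homChains R X Y 1)
    (h : ((homComplex X Y).d 1 0).hom s = homToChain f - homToChain g) : Homotopy f g where
  hom i j := s.1 i j
  zero i j hij := s.2.1 i j hij
  comm i := by
    have h1 : s.1 i (i + 1) ≫ Y.d (i + 1) i - (-1 : R) ^ 1 • (X.d i (i - 1) ≫ s.1 (i - 1) i) =
        (homToChain f).1 i i - (homToChain g).1 i i :=
      (congrFun (congrFun (homComplex_d_apply 0 s) i) i).symm.trans
        (congrArg (fun x : homChains R X Y 0 => x.1 i i) h)
    rw [homToChain_self, homToChain_self, pow_one, neg_one_smul, sub_neg_eq_add] at h1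
    rw [← sub_eq_iff_eq_add, ← h1, Homotopy.prevD_chainComplex, add_comm]
    obtain _ | i := i
    · rw [X.shape _ _ (by simp), Limits.zero_comp, Homotopy.dNext_zero_chainComplex]
    · rw [Homotopy.dNext_succ_chainComplex, Nat.add_sub_cancel]

end lowDegree

variable {A B K A' B' K' : SimplicialObject (ModuleCat.{u} R)}

lemma stepMap_univ {p : ℕ} (h : (Finset.univ : Finset (Fin p)).card = p) :
    stepMap Finset.univ h = 𝟙 ⦋p⦌ :=
  simplexHom_ext fun x => by
    rw [stepMap_apply]
    change _ = (x : ℕ)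
    have hx : (x : ℕ) < p + 1 := x.2
    rw [Fin.card_filter_val_lt]
    omega

lemma shuffleN_zero_right (A K : SimplicialObject (ModuleCat.{u} R)) (p : ℕ) :
    shuffleN A K p 0 p = tensorMap A K (𝟙 _) (SimplexCategory.const ⦋p⦌ ⦋0⦌ 0) := by
  have h : (Finset.univ : Finset (Fin p)).card = p := Finset.card_fin p
  have h' : (Finset.univ : Finset (Fin p))ᶜ.card = 0 := by simp
  rw [shuffleN, Finset.sum_eq_single Finset.univ, shuffleTerm_of_card A K _ h h', stepMap_univ,
    show inversions (Finset.univ : Finset (Fin p)) = 0 by simp [inversions], pow_zero]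
  · refine (one_smul _ _).trans (congrArg (tensorMap A K (𝟙 _)) (simplexHom_ext fun x => ?_))
    have h1 := ((stepMap (Finset.univ : Finset (Fin p))ᶜ h').toOrderHom x).2
    have h2 := ((SimplexCategory.const ⦋p⦌ ⦋0⦌ 0).toOrderHom x).2
    change _ < 0 + 1 at h1
    change _ < 0 + 1 at h2
    omega
  · intro μ _ hμ
    refine shuffleTerm_eq_zero A K μ fun h => hμ ?_
    rw [← Finset.card_eq_iff_eq_univ, h.1, Fintype.card_fin]
  · intro h
    exact absurd (Finset.mem_univ _) h

/-- The only `(p, 0)`-shuffle pairs a simplex with the iterated degeneracy of the vertex, and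
evaluating there is applying `α`. -/
lemma ezDual_vertex (α : A ⟶ B) :
    ((ezDual A B).f 0).hom ((normProj (simplicialHom.obj (op A, B)) 0).hom (vertex α)) =
      homToChain ((normalization R).map α) := by
  refine homChains_ext fun p q hq => ?_
  obtain rfl : p = q := hq
  rw [homToChain_self]
  refine ModuleCat.hom_ext (LinearMap.ext fun x => ?_)
  have h1 : (((ezDual A B).f 0).hom ((normProj (simplicialHom.obj (op A, B)) 0).hom (vertex α)) :
      homChains R _ _ 0).1 p p = (-1 : R) ^ (p * 0) • partialMap
        (EZn A (simplicialHom.obj (op A, B)) p 0 p ≫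
          ((normalization R).map (simplicialEval A B)).f p)
        ((normProj (simplicialHom.obj (op A, B)) 0).hom (vertex α)) := rfl
  have h2 : (normIncl (simplicialHom.obj (op A, B)) 0).hom
      ((normProj (simplicialHom.obj (op A, B)) 0).hom (vertex α)) = vertex α :=
    congrArg (fun f => f.hom (vertex α)) (normProj_normIncl_zero _)
  have h3 : EZn A (simplicialHom.obj (op A, B)) p 0 p ≫
      ((normalization R).map (simplicialEval A B)).f p =
      normIncl₂ A _ p 0 ≫ tensorMap A _ (𝟙 _) (SimplexCategory.const ⦋p⦌ ⦋0⦌ 0) ≫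
        (simplicialEval A B).app (op ⦋p⦌) ≫ normProj B p := by
    rw [EZn, Category.assoc, Category.assoc, ← app_normProj, shuffleN_zero_right]
  rw [h1, h3, mul_zero, pow_zero, one_smul]
  change (normProj B p).hom (pairing (simplicialEval A B) (op ⦋p⦌)
    ((A.map (𝟙 _)).hom ((normIncl A p).hom x))
    (((simplicialHom.obj (op A, B)).map (SimplexCategory.const ⦋p⦌ ⦋0⦌ 0).op).hom
      ((normIncl (simplicialHom.obj (op A, B)) 0).hom
        ((normProj (simplicialHom.obj (op A, B)) 0).hom (vertex α))))) = _
  rw [h2, A.map_id, pairing_eval, pairing_toHom_map, pairing_vertex]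
  have h4 : normIncl A p ≫ α.app (op ⦋p⦌) ≫ normProj B p = ((normalization R).map α).f p := by
    rw [app_normProj, ← Category.assoc, normIncl_normProj, Category.id_comp]
  exact congrArg (fun f => f.hom x) h4

/-- Every 0-chain of `N(B^A)` comes from a vertex `β`. For the value in question, applying `ezDual`
gives `N β = N α` by `awDual_ezDual` and `ezDual_vertex`, and `N` is faithful. -/
lemma awDual_homToChain (α : A ⟶ B) :
    ((awDual A B).f 0).hom (homToChain ((normalization R).map α)) =
      (normProj (simplicialHom.obj (op A, B)) 0).hom (vertex α) := by
  have h1 (k) : ∃ β : A ⟶ B, (normProj (simplicialHom.obj (op A, B)) 0).hom (vertex β) = k := by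
    obtain ⟨β, hβ⟩ := vertex_surjective ((normIncl (simplicialHom.obj (op A, B)) 0).hom k)
    refine ⟨β, ?_⟩
    rw [hβ]
    exact congrArg (fun f => f.hom k) (normIncl_normProj _ 0)
  obtain ⟨β, hβ⟩ := h1 (((awDual A B).f 0).hom (homToChain ((normalization R).map α)))
  have h2 : ((ezDual A B).f 0).hom (((awDual A B).f 0).hom
      (homToChain ((normalization R).map α))) = homToChain ((normalization R).map α) :=
    congrArg (fun f => (f.f 0).hom (homToChain ((normalization R).map α))) (awDual_ezDual A B)
  rw [← hβ, ezDual_vertex] at h2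
  rw [← hβ, (normalization R).map_injective (homToChain_injective h2)]

/-- The map `Hom(N(A ⊗ K), N B) ⟶ Hom(N K, N(B^A))` induced by currying. -/
def normCurry (A K B : SimplicialObject (ModuleCat.{u} R)) :
    normHomComplex (A ⊗ K) B ⟶ normHomComplex K (simplicialHom.obj (op A, B)) :=
  awDual (A ⊗ K) B ≫ (normalization R).map (curryHom A K B) ≫ ezDual K _

lemma normCurry_naturality (α : A' ⟶ A) (κ : K' ⟶ K) (β : B ⟶ B') :
    homComplexMap ((normalization R).map (α ⊗ₘ κ)) ((normalization R).map β) ≫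
        normCurry A' K' B' = normCurry A K B ≫
      homComplexMap ((normalization R).map κ) ((normalization R).map (simplicialHomMap α β)) := by
  rw [normCurry, normCurry, reassoc_of% @awDual_naturality, Category.assoc, Category.assoc,
    ← ezDual_naturality, ← Functor.map_comp_assoc, ← Functor.map_comp_assoc, curryHom_naturality]

lemma normCurry_homToChain (f : A ⊗ K ⟶ B) :
    ((normCurry A K B).f 0).hom (homToChain ((normalization R).map f)) =
      homToChain ((normalization R).map (curry f)) := by
  have h : (((normalization R).map (curryHom A K B)).f 0).hom
      ((normProj (simplicialHom.obj (op (A ⊗ K), B)) 0).hom (vertex f)) =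
      (normProj (simplicialHom.obj (op K, simplicialHom.obj (op A, B))) 0).hom
        (vertex (curry f)) := by
    rw [← curryHom_vertex]
    exact congrArg (fun g => g.hom (vertex f)) (app_normProj 0 (curryHom A K B)).symm
  refine Eq.trans ?_ (ezDual_vertex (curry f))
  rw [← h, ← awDual_homToChain]
  rfl

/-- The chain of degree one in `Hom(N(A ⊗ B^A), N B)` given by the homotopy on `N(A ⊗ B^A)`. -/
def shihChain (A B : SimplicialObject (ModuleCat.{u} R)) :
    homChains R ((normalization R).obj (A ⊗ simplicialHom.obj (op A, B)))
      ((normalization R).obj B) 1 :=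
  chainOfHoms fun p => shih A _ p ≫ ((normalization R).map (simplicialEval A B)).f (p + 1)

lemma d_shihChain (A B : SimplicialObject (ModuleCat.{u} R)) :
    ((homComplex _ _).d 1 0).hom (shihChain A B) =
      homToChain ((normalization R).map (awTranspose (ezDual A B))) -
        homToChain ((normalization R).map (simplicialEval A B)) := by
  refine d_chainOfHoms _ _ _ ?_ fun p => ?_
  · rw [shih_zero, map_awTranspose_ezDual, HomologicalComplex.comp_f, awEZ_f_zero, Limits.zero_comp,
      Limits.zero_comp, Category.id_comp, sub_self]
  · rw [Category.assoc, HomologicalComplex.Hom.comm, ← Category.assoc, ← Category.assoc,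
      ← Preadditive.add_comp, shih_comm, map_awTranspose_ezDual, HomologicalComplex.comp_f,
      awEZDefect, HomologicalComplex.sub_f_apply, Preadditive.sub_comp, HomologicalComplex.id_f,
      Category.id_comp]

lemma eval_naturality (α : A' ⟶ A) (β : B ⟶ B') :
    (A' ◁ simplicialHomMap α β) ≫ simplicialEval A' B' =
      (α ▷ simplicialHom.obj (op A, B)) ≫ simplicialEval A B ≫ β :=
  pairing_ext fun _ _ _ => rfl

lemma simplicialHomMap_id (A B : SimplicialObject (ModuleCat.{u} R)) :
    simplicialHomMap (𝟙 A) (𝟙 B) = 𝟙 _ :=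
  simplicialHom.map_id (op A, B)

/-- `B^A` also occurs in the source, so naturality is dinatural: both chains are compared in
`Hom(N(A' ⊗ B^A), N B')`. -/
lemma shihChain_naturality (α : A' ⟶ A) (β : B ⟶ B') :
    ((homComplexMap ((normalization R).map (𝟙 A' ⊗ₘ simplicialHomMap α β))
        ((normalization R).map (𝟙 B'))).f 1).hom
        (shihChain A' B') =
      ((homComplexMap ((normalization R).map (α ⊗ₘ 𝟙 _)) ((normalization R).map β)).f 1).hom
        (shihChain A B) := by
  refine homChains_ext fun p q hq => ?_
  subst hq
  rw [homComplexMap_apply, homComplexMap_apply, shihChain, shihChain, chainOfHoms_self,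
    chainOfHoms_self, ← Category.assoc, ← Category.assoc, ← Category.assoc, ← Category.assoc,
    shih_naturality, shih_naturality, Category.assoc, Category.assoc, Category.assoc,
    Category.assoc, ← HomologicalComplex.comp_f, ← HomologicalComplex.comp_f,
    ← HomologicalComplex.comp_f, ← HomologicalComplex.comp_f, ← Functor.map_comp,
    ← Functor.map_comp, ← Functor.map_comp, ← Functor.map_comp, id_tensorHom, tensorHom_id,
    Category.comp_id, eval_naturality]

/-- The chain of degree one underlying the homotopy. -/
def homotopyChain (A B : SimplicialObject (ModuleCat.{u} R)) :
    homChains R ((normalization R).obj (simplicialHom.obj (op A, B)))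
      ((normalization R).obj (simplicialHom.obj (op A, B))) 1 :=
  ((normCurry A (simplicialHom.obj (op A, B)) B).f 1).hom (shihChain A B)

/-- The chain map `normCurry` is applied to `d_shihChain`; evaluation curries to the identity. -/
lemma d_homotopyChain (A B : SimplicialObject (ModuleCat.{u} R)) :
    ((homComplex _ _).d 1 0).hom (homotopyChain A B) =
      homToChain (ezDual A B ≫ awDual A B) - homToChain (𝟙 _) := by
  have h := congrArg (fun f => f.hom (shihChain A B))
    ((normCurry A (simplicialHom.obj (op A, B)) B).comm 1 0)
  refine h.trans ?_
  refine (congrArg ((normCurry A (simplicialHom.obj (op A, B)) B).f 0).hom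
    (d_shihChain A B)).trans ?_
  refine (map_sub _ _ _).trans ?_
  rw [normCurry_homToChain, normCurry_homToChain, curry_eval, CategoryTheory.Functor.map_id,
    ezDual_awDual]
  rfl

lemma homotopyChain_naturality (α : A' ⟶ A) (β : B ⟶ B') (i j : ℕ) :
    ((normalization R).map (simplicialHomMap α β)).f i ≫ (homotopyChain A' B').1 i j =
      (homotopyChain A B).1 i j ≫ ((normalization R).map (simplicialHomMap α β)).f j := by
  -- Naturality of `normCurry` is used twice: in the middle variable along `B^A ⟶ B'^A'`, and in the
  -- outer variables along `α` and `β`. The dinaturality of `shihChain` joins the two.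
  have h1 := congrArg (fun f => ((f.f 1).hom (shihChain A' B') : homChains R _ _ 1).1 i j)
    (normCurry_naturality (𝟙 A') (simplicialHomMap α β) (𝟙 B'))
  have h2 := congrArg (fun f => ((f.f 1).hom (shihChain A B) : homChains R _ _ 1).1 i j)
    (normCurry_naturality α (𝟙 (simplicialHom.obj (op A, B))) β)
  have h3 := congrArg (fun f => (((normCurry A' (simplicialHom.obj (op A, B)) B').f 1).hom f :
    homChains R _ _ 1).1 i j) (shihChain_naturality α β)
  have h4 : ((normalization R).map (simplicialHomMap α β)).f i ≫ (homotopyChain A' B').1 i j ≫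
      ((normalization R).map (simplicialHomMap (𝟙 A') (𝟙 B'))).f j =
      ((normalization R).map (𝟙 (simplicialHom.obj (op A, B)))).f i ≫ (homotopyChain A B).1 i j ≫
        ((normalization R).map (simplicialHomMap α β)).f j := h1.symm.trans (h3.trans h2)
  rwa [simplicialHomMap_id, CategoryTheory.Functor.map_id, CategoryTheory.Functor.map_id,
    HomologicalComplex.id_f, HomologicalComplex.id_f, Category.comp_id, Category.id_comp] at h4

/-! ### Assembly: the dual maps as natural transformations, with their natural homotopy. -/

lemma isEZDual_ezDual (A B : SimplicialObject (ModuleCat.{u} R)) :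
    IsEZDual (A := A) (B := B) (ezDual A B) := fun K ψ p q => by
  rw [EZ_eq]
  exact chainTranspose_ezDual ψ p q (p + q)

lemma isAWDual_awDual (A B : SimplicialObject (ModuleCat.{u} R)) :
    IsAWDual (A := A) (B := B) (awDual A B) := fun K ψ φ h n => by
  have h1 : (normalization R).map ψ = (normalization R).map (curry (awTranspose φ)) :=
    h.trans (comp_awDual φ)
  rw [(normalization R).map_injective h1, simplicialTranspose_curry]
  exact (HomologicalComplex.congr_hom (map_awTranspose φ) n).trans (awComp_f_eq_sum_AW _ _ n)

variable (R) in
/-- The dual of the Eilenberg--Zilber map, as a natural transformation. -/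
def ezDualTrans : normHom R ⟶ homNorm R where
  app P := ezDual P.1.unop P.2
  naturality _ _ φ := ezDual_naturality φ.1.unop φ.2

variable (R) in
/-- The dual of the Alexander--Whitney map, as a natural transformation. -/
def awDualTrans : homNorm R ⟶ normHom R where
  app P := awDual P.1.unop P.2
  naturality _ _ φ := awDual_naturality φ.1.unop φ.2

lemma awDualTrans_ezDualTrans : awDualTrans R ≫ ezDualTrans R = 𝟙 (homNorm R) :=
  NatTrans.ext (funext fun P => awDual_ezDual P.1.unop P.2)

/-- The natural homotopy from `ezDual ≫ awDual` to the identity. -/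
def dualHomotopy (P : (SimplicialObject (ModuleCat.{u} R))ᵒᵖ × SimplicialObject (ModuleCat.{u} R)) :
    Homotopy ((ezDualTrans R).app P ≫ (awDualTrans R).app P) (𝟙 ((normHom R).obj P)) :=
  homotopyOfChain _ _ (homotopyChain P.1.unop P.2) (d_homotopyChain P.1.unop P.2)

end

end SMod

end

theorem proposition4p1 (R : Type u) [CommRing R] :
    ∃ (EZdual : SMod.normHom R ⟶ SMod.homNorm R) (AWdual : SMod.homNorm R ⟶ SMod.normHom R),
      (∀ A B : SimplicialObject (ModuleCat.{u} R), SMod.IsEZDual (EZdual.app (op A, B))) ∧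
      (∀ A B : SimplicialObject (ModuleCat.{u} R), SMod.IsAWDual (AWdual.app (op A, B))) ∧
      AWdual ≫ EZdual = 𝟙 (SMod.homNorm R) ∧
      ∃ h : ∀ P : (SimplicialObject (ModuleCat.{u} R))ᵒᵖ × SimplicialObject (ModuleCat.{u} R),
          Homotopy (EZdual.app P ≫ AWdual.app P) (𝟙 ((SMod.normHom R).obj P)),
        ∀ (P Q : (SimplicialObject (ModuleCat.{u} R))ᵒᵖ × SimplicialObject (ModuleCat.{u} R))
          (φ : P ⟶ Q) (i j : ℕ),
          ((SMod.normHom R).map φ).f i ≫ (h Q).hom i j =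
            (h P).hom i j ≫ ((SMod.normHom R).map φ).f j := by
  exact ⟨SMod.ezDualTrans R, SMod.awDualTrans R, SMod.isEZDual_ezDual, SMod.isAWDual_awDual,
    SMod.awDualTrans_ezDualTrans, SMod.dualHomotopy,
    fun P Q φ i j => SMod.homotopyChain_naturality φ.1.unop φ.2 i j⟩
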